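/- Let $\mathfrak h$ be a finite-dimensional complex vector space, $W\subset GL(\mathfrak h)$ a finite subgroup, and $S$ the set of reflections in $W$, i.e. of the $s\in W$, $s\neq 1$, with $\operatorname{rk}(s-1)=1$. For $s\in S$ let $\alpha_s\in\mathfrak h^*$ be a generator of $\operatorname{Im}(s|_{\mathfrak h^*}-1)$, let $\alpha_s^\vee\in\mathfrak h$ be the generator of $\operatorname{Im}(s|_{\mathfrak h}-1)$ with $(\alpha_s,\alpha_s^\vee)=2$, and let $\lambda_s$ be the nontrivial eigenvalue of $s$ in $\mathfrak h^*$. Let $c:S\to\mathbb C$ be a $W$-invariant function. The rational Cherednik algebra $H_c(W,\mathfrak h)$ is the quotient of $\mathbb C W\ltimes T(\mathfrak h\oplus\mathfrak h^*)$ by the relations $[x,x']=0$, $[y,y']=0$, $[y,x]=(y,x)-\sum_{s\in S}c_s(y,\alpha_s)(x,\alpha_s^\vee)s$ for $x,x'\in\mathfrak h^*$, $y,y'\in\mathfrak h$; we write $x_\alpha$ and $y_a$ for its elements given by $\alpha\in\mathfrak h^*$ and $a\in\mathfrak h$. For $b\in\mathfrak h$, the completion $\widehat{H_c}(W,\mathfrak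 h)_b$ of $H_c(W,\mathfrak h)$ at the image of $b$ in $\mathfrak h/W$ is the algebra of linear operators on the algebra of regular functions on the formal neighborhood of the orbit $Wb$ in $\mathfrak h$ (the completion of $\mathbb C[\mathfrak h]$ at the ideal of $Wb$) generated by multiplications by these functions, the group $W$, and the Dunkl--Opdam operators $$D_a=\partial_a+\sum_{s\in S}\frac{2c_s}{1-\lambda_s}\frac{\alpha_s(a)}{\alpha_s}(s-1),\qquad a\in\mathfrak h .$$ There is a natural homomorphism $H_c(W,\mathfrak h)\to\widehat{H_c}(W,\mathfrak h)_b$, given by $w\mapsto w$ for $w\in W$, $x_\alpha\mapsto\alpha$, $y_a\mapsto D_a$; images of elements under it are denoted by the same letters. For finite groups $H\subset G$ and an algebra $A$ with a homomorphism from $H$ to its group of units, let $Z(G,H,A)=\operatorname{End}_A(P)$, where $P=\operatorname{Fun}_H(G,A)$ is the right $A$-module of functions $f:G\to A$ with $f(hg)=hf(g)$ for $h\in H$, $g\in G$. Let $b\in\mathfrak h$, let $W_b$ be its stabilizer in $W$, and let $c'$ be the restriction of $c$ to the set of reflections in $W_b$. Then the natural homomorphisms above exist for $H_c(W,\mathfrak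 h)$ at $b$ and for $H_{c'}(W_b,\mathfrak h)$ at $0$, and there is a unique isomorphism of $\mathbb C$-algebras $$\theta:\widehat{H_c}(W,\mathfrak h)_b\to Z\bigl(W,W_b,\widehat{H_{c'}}(W_b,\mathfrak h)_0\bigr)$$ such that for all $f\in P=\operatorname{Fun}_{W_b}(W,\widehat{H_{c'}}(W_b,\mathfrak h)_0)$ and $w\in W$: $$(\theta(u)f)(w)=f(wu)\quad(u\in W),$$ $$(\theta(x_\alpha)f)(w)=\bigl(x^{(b)}_{w\alpha}+(w\alpha,b)\bigr)f(w)\quad(\alpha\in\mathfrak h^*),$$ $$(\theta(y_a)f)(w)=y^{(b)}_{wa}f(w)+\sum_{s\in S:\,s\notin W_b}\frac{2c_s}{1-\lambda_s}\,\frac{\alpha_s(wa)}{x^{(b)}_{\alpha_s}+\alpha_s(b)}\,\bigl(f(sw)-f(w)\bigr)\quad(a\in\mathfrak h),$$ where $x^{(b)}_\alpha$, $y^{(b)}_a$ are the elements of $H_{c'}(W_b,\mathfrak h)$ corresponding to $\alpha$, $a$, and the fraction is understood as an element of $\mathbb C[[\mathfrak h]]$ (note that $\alpha_s(b)\ne0$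 for $s\notin W_b$). -/

import Mathlib

namespace Cherednik

noncomputable section

open Module

variable {V : Type*} [AddCommGroup V] [Module ℂ V]

/-- The action of `w ∈ GL(V)` on `V*`: `(w α)(v) = α (w⁻¹ v)`. -/
def dualAct (w : V ≃ₗ[ℂ] V) : Dual ℂ V →ₗ[ℂ] Dual ℂ V :=
  (w⁻¹ : V ≃ₗ[ℂ] V).toLinearMap.dualMap

/-- The set `S` of (complex) reflections in `W`: the `s ≠ 1` in `W` with `rk (s - 1) = 1`. -/
def reflections (W : Subgroup (V ≃ₗ[ℂ] V)) : Set (V ≃ₗ[ℂ] V) :=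
  {s | s ∈ W ∧ s ≠ 1 ∧ finrank ℂ (LinearMap.range (s.toLinearMap - LinearMap.id)) = 1}

/-- A choice, for every reflection `s ∈ W`, of a generator `α_s` of `Im (s - 1)` in `V*` and of the
generator `α_s^∨` of `Im (s - 1)` in `V` with `(α_s, α_s^∨) = 2`; `eig s` is the nontrivial
eigenvalue `λ_s` of `s` in `V*`, which is the eigenvalue of `s` on `α_s`. -/
structure Roots (W : Subgroup (V ≃ₗ[ℂ] V)) where
  root : reflections W → Dual ℂ V
  coroot : reflections W → V
  eig : reflections W → ℂ
  span_root : ∀ s : reflections W, Submodule.span ℂ {root s} =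
    LinearMap.range (dualAct (s : V ≃ₗ[ℂ] V) - LinearMap.id)
  span_coroot : ∀ s : reflections W, Submodule.span ℂ {coroot s} =
    LinearMap.range ((s : V ≃ₗ[ℂ] V).toLinearMap - LinearMap.id)
  pairing : ∀ s, root s (coroot s) = 2
  eig_spec : ∀ s : reflections W, dualAct (s : V ≃ₗ[ℂ] V) (root s) = eig s • root s

/-- `c : S → ℂ` is `W`-invariant, i.e. constant on `W`-conjugacy classes of reflections. -/
def IsInvariant {W : Subgroup (V ≃ₗ[ℂ] V)} (c : reflections W → ℂ) : Prop :=
  ∀ s t : reflections W, ∀ w ∈ W, w * (s : V ≃ₗ[ℂ] V) * w⁻¹ = t → c t = c s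

/-! ### Passing to a subgroup -/

lemma reflections_mono {W' W : Subgroup (V ≃ₗ[ℂ] V)} (h : W' ≤ W) :
    reflections W' ⊆ reflections W := fun _ hs => ⟨h hs.1, hs.2⟩

/-- The restriction of a function on the reflections of `W` to the reflections of `W'`. -/
def restrictParam {W' W : Subgroup (V ≃ₗ[ℂ] V)} (h : W' ≤ W) (c : reflections W → ℂ) :
    reflections W' → ℂ := fun s => c (Set.inclusion (reflections_mono h) s)

/-- The same `α_s`, `α_s^∨`, for the reflections of `W'` only. -/
def Roots.restrict {W' W : Subgroup (V ≃ₗ[ℂ] V)} (r : Roots W) (h : W' ≤ W) : Roots W' where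
  root s := r.root (Set.inclusion (reflections_mono h) s)
  coroot s := r.coroot (Set.inclusion (reflections_mono h) s)
  eig s := r.eig (Set.inclusion (reflections_mono h) s)
  span_root s := r.span_root (Set.inclusion (reflections_mono h) s)
  span_coroot s := r.span_coroot (Set.inclusion (reflections_mono h) s)
  pairing s := r.pairing (Set.inclusion (reflections_mono h) s)
  eig_spec s := r.eig_spec (Set.inclusion (reflections_mono h) s)

/-- The stabilizer `W_b` of `b` in `W`. -/
def pointStabilizer (W : Subgroup (V ≃ₗ[ℂ] V)) (b : V) : Subgroup (V ≃ₗ[ℂ] V) :=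
  W ⊓ MulAction.stabilizer (V ≃ₗ[ℂ] V) b

lemma pointStabilizer_le (W : Subgroup (V ≃ₗ[ℂ] V)) (b : V) : pointStabilizer W b ≤ W :=
  inf_le_left

/-! ### The rational Cherednik algebra `H_c(W, V)` -/

/-- Generators of the rational Cherednik algebra: `w ∈ W`, `x_α` for `α ∈ V*`, `y_a` for `a ∈ V`. -/
inductive Gen (W : Subgroup (V ≃ₗ[ℂ] V)) : Type _
  | grp (w : W)
  | x (α : Dual ℂ V)
  | y (a : V)

section Presentation

variable {W : Subgroup (V ≃ₗ[ℂ] V)}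

/-- The defining relations. The first eight families present `ℂ W ⋉ T(V ⊕ V*)`; the last three are
the relations `[x, x'] = 0`, `[y, y'] = 0` and
`[y, x] = (y, x) - ∑ s ∈ S, c_s (y, α_s) (x, α_s^∨) s`. -/
inductive Rel (r : Roots W) (c : reflections W → ℂ) :
    FreeAlgebra ℂ (Gen W) → FreeAlgebra ℂ (Gen W) → Prop
  | grp_one : Rel r c (FreeAlgebra.ι ℂ (Gen.grp 1)) 1
  | grp_mul (u v : W) : Rel r c (FreeAlgebra.ι ℂ (Gen.grp (u * v)))
      (FreeAlgebra.ι ℂ (Gen.grp u) * FreeAlgebra.ι ℂ (Gen.grp v))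
  | x_add (α β : Dual ℂ V) : Rel r c (FreeAlgebra.ι ℂ (Gen.x (α + β)))
      (FreeAlgebra.ι ℂ (Gen.x α) + FreeAlgebra.ι ℂ (Gen.x β))
  | x_smul (t : ℂ) (α : Dual ℂ V) : Rel r c (FreeAlgebra.ι ℂ (Gen.x (t • α)))
      (t • FreeAlgebra.ι ℂ (Gen.x α))
  | y_add (a a' : V) : Rel r c (FreeAlgebra.ι ℂ (Gen.y (a + a')))
      (FreeAlgebra.ι ℂ (Gen.y a) + FreeAlgebra.ι ℂ (Gen.y a'))
  | y_smul (t : ℂ) (a : V) : Rel r c (FreeAlgebra.ι ℂ (Gen.y (t • a)))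
      (t • FreeAlgebra.ι ℂ (Gen.y a))
  | grp_x (w : W) (α : Dual ℂ V) :
      Rel r c (FreeAlgebra.ι ℂ (Gen.grp w) * FreeAlgebra.ι ℂ (Gen.x α))
        (FreeAlgebra.ι ℂ (Gen.x (dualAct (w : V ≃ₗ[ℂ] V) α)) * FreeAlgebra.ι ℂ (Gen.grp w))
  | grp_y (w : W) (a : V) :
      Rel r c (FreeAlgebra.ι ℂ (Gen.grp w) * FreeAlgebra.ι ℂ (Gen.y a))
        (FreeAlgebra.ι ℂ (Gen.y ((w : V ≃ₗ[ℂ] V) a)) * FreeAlgebra.ι ℂ (Gen.grp w))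
  | x_comm (α β : Dual ℂ V) :
      Rel r c (FreeAlgebra.ι ℂ (Gen.x α) * FreeAlgebra.ι ℂ (Gen.x β))
        (FreeAlgebra.ι ℂ (Gen.x β) * FreeAlgebra.ι ℂ (Gen.x α))
  | y_comm (a a' : V) :
      Rel r c (FreeAlgebra.ι ℂ (Gen.y a) * FreeAlgebra.ι ℂ (Gen.y a'))
        (FreeAlgebra.ι ℂ (Gen.y a') * FreeAlgebra.ι ℂ (Gen.y a))
  | y_x (a : V) (α : Dual ℂ V) :
      Rel r c (FreeAlgebra.ι ℂ (Gen.y a) * FreeAlgebra.ι ℂ (Gen.x α) -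
          FreeAlgebra.ι ℂ (Gen.x α) * FreeAlgebra.ι ℂ (Gen.y a))
        (algebraMap ℂ _ (α a) - ∑ᶠ s : reflections W,
          (c s * r.root s a * α (r.coroot s)) • FreeAlgebra.ι ℂ (Gen.grp ⟨s, s.2.1⟩))

/-- The rational Cherednik algebra `H_c(W, V)`. -/
abbrev Alg (r : Roots W) (c : reflections W → ℂ) : Type _ := RingQuot (Rel r c)

variable (r : Roots W) (c : reflections W → ℂ)

/-- The element `w` of `H_c(W, V)`. -/
def Alg.grp (w : W) : Alg r c := RingQuot.mkAlgHom ℂ (Rel r c) (FreeAlgebra.ι ℂ (Gen.grp w))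

/-- The element `x_α` of `H_c(W, V)`. -/
def Alg.x (α : Dual ℂ V) : Alg r c := RingQuot.mkAlgHom ℂ (Rel r c) (FreeAlgebra.ι ℂ (Gen.x α))

/-- The element `y_a` of `H_c(W, V)`. -/
def Alg.y (a : V) : Alg r c := RingQuot.mkAlgHom ℂ (Rel r c) (FreeAlgebra.ι ℂ (Gen.y a))

end Presentation

/-! ### Polynomial functions on `V` and Dunkl operators -/

variable (V) in
/-- The algebra `ℂ[V] = S(V*)` of polynomial functions on `V`. -/
abbrev Poly : Type _ := SymmetricAlgebra ℂ (Dual ℂ V)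

/-- A linear form as a polynomial function. -/
abbrev lin (α : Dual ℂ V) : Poly V := SymmetricAlgebra.ι ℂ (Dual ℂ V) α

/-- Evaluation of polynomial functions at the point `p`. -/
def evalAt (p : V) : Poly V →ₐ[ℂ] ℂ := SymmetricAlgebra.lift (Dual.eval ℂ V p)

/-- The action of `w ∈ GL(V)` on polynomial functions: `(w F)(v) = F (w⁻¹ v)`. -/
def polyAct (w : V ≃ₗ[ℂ] V) : Poly V →ₐ[ℂ] Poly V :=
  SymmetricAlgebra.lift (SymmetricAlgebra.ι ℂ (Dual ℂ V) ∘ₗ dualAct w)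

/-- `F(v) ↦ F(v + ε a)`, with values in the dual numbers. -/
def infinitesimalShift (a : V) : Poly V →ₐ[ℂ] DualNumber (Poly V) :=
  SymmetricAlgebra.lift
    ((TrivSqZeroExt.inlAlgHom ℂ (Poly V) (Poly V)).toLinearMap ∘ₗ
        SymmetricAlgebra.ι ℂ (Dual ℂ V) +
      (TrivSqZeroExt.inrHom (Poly V) (Poly V)).restrictScalars ℂ ∘ₗ
        Algebra.linearMap ℂ (Poly V) ∘ₗ Dual.eval ℂ V a)

/-- The directional derivative `∂_a` on polynomial functions: the coefficient of `ε` in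
`F(v + ε a)`. -/
def deriv (a : V) : Poly V →ₗ[ℂ] Poly V :=
  (TrivSqZeroExt.sndHom (Poly V) (Poly V)).restrictScalars ℂ ∘ₗ
    (infinitesimalShift a).toLinearMap

lemma fst_infinitesimalShift (a : V) (F : Poly V) : (infinitesimalShift a F).fst = F := by
  have h : (TrivSqZeroExt.fstHom ℂ (Poly V) (Poly V)).comp (infinitesimalShift a) =
      AlgHom.id ℂ (Poly V) := by
    apply SymmetricAlgebra.algHom_ext
    ext α
    simp [infinitesimalShift]
  exact DFunLike.congr_fun h F

lemma deriv_lin (a : V) (α : Dual ℂ V) : deriv a (lin α) = algebraMap ℂ _ (α a) := by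
  simp [deriv, infinitesimalShift, Algebra.algebraMap_eq_smul_one]

lemma deriv_mul (a : V) (F G : Poly V) : deriv a (F * G) = deriv a F * G + F * deriv a G := by
  simp only [deriv, LinearMap.comp_apply, AlgHom.toLinearMap_apply, map_mul,
    LinearMap.restrictScalars_apply, TrivSqZeroExt.sndHom_apply, TrivSqZeroExt.snd_mul,
    fst_infinitesimalShift, smul_eq_mul, MulOpposite.smul_eq_mul_unop, MulOpposite.unop_op]
  ring

section Dunkl

variable {W : Subgroup (V ≃ₗ[ℂ] V)} (r : Roots W)

lemma root_ne_zero (s : reflections W) : r.root s ≠ 0 := by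
  intro h
  have := r.pairing s
  simp [h] at this

lemma lin_injective : Function.Injective (lin : Dual ℂ V → Poly V) := by
  intro α β h
  ext a
  have := congrArg (deriv a) h
  simpa [deriv_lin] using this

lemma lin_root_ne_zero (s : reflections W) : lin (r.root s) ≠ 0 := by
  intro h
  exact root_ne_zero r s (lin_injective (by simpa using h))

lemma mul_root_injective (s : reflections W) :
    Function.Injective (LinearMap.mulLeft ℂ (lin (r.root s))) := by
  intro F G h
  exact mul_left_cancel₀ (lin_root_ne_zero r s) h

lemma root_dvd (s : reflections W) (F : Poly V) :
    lin (r.root s) ∣ polyAct (s : V ≃ₗ[ℂ] V) F - F := by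
  induction F using SymmetricAlgebra.induction with
  | algebraMap t => simp
  | ι α =>
    have h : (dualAct (s : V ≃ₗ[ℂ] V) - LinearMap.id : Dual ℂ V →ₗ[ℂ] Dual ℂ V) α ∈ Submodule.span ℂ {r.root s} := by
      rw [r.span_root s]; exact ⟨α, rfl⟩
    obtain ⟨t, ht⟩ := Submodule.mem_span_singleton.1 h
    refine ⟨algebraMap ℂ _ t, ?_⟩
    have : polyAct (s : V ≃ₗ[ℂ] V) (lin α) - lin α =
        lin ((dualAct (s : V ≃ₗ[ℂ] V) - LinearMap.id : Dual ℂ V →ₗ[ℂ] Dual ℂ V) α) := by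
      simp [polyAct]
    rw [this, ← ht, lin, map_smul, Algebra.smul_def, mul_comm]
  | mul F G hF hG =>
    have : polyAct (s : V ≃ₗ[ℂ] V) (F * G) - F * G =
        (polyAct (s : V ≃ₗ[ℂ] V) F - F) * G +
          polyAct (s : V ≃ₗ[ℂ] V) F * (polyAct (s : V ≃ₗ[ℂ] V) G - G) := by
      rw [map_mul]; ring
    rw [this]
    exact dvd_add (hF.mul_right _) (hG.mul_left _)
  | add F G hF hG =>
    have : polyAct (s : V ≃ₗ[ℂ] V) (F + G) - (F + G) =
        (polyAct (s : V ≃ₗ[ℂ] V) F - F) + (polyAct (s : V ≃ₗ[ℂ] V) G - G) := by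
      rw [map_add]; ring
    rw [this]
    exact dvd_add hF hG

lemma root_act_sub_mem (s : reflections W) (F : Poly V) :
    ((polyAct (s : V ≃ₗ[ℂ] V)).toLinearMap - LinearMap.id : Poly V →ₗ[ℂ] Poly V) F ∈
      LinearMap.range (LinearMap.mulLeft ℂ (lin (r.root s))) := by
  obtain ⟨G, hG⟩ := root_dvd r s F
  exact ⟨G, hG.symm⟩

/-- The operator `F ↦ (s F - F) / α_s` on polynomial functions. -/
def divDiff (s : reflections W) : Poly V →ₗ[ℂ] Poly V :=
  (LinearEquiv.ofInjective _ (mul_root_injective r s)).symm.toLinearMap ∘ₗ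
    ((polyAct (s : V ≃ₗ[ℂ] V)).toLinearMap - LinearMap.id).codRestrict
      (LinearMap.range (LinearMap.mulLeft ℂ (lin (r.root s))))
      (root_act_sub_mem r s)

lemma root_mul_divDiff (s : reflections W) (F : Poly V) :
    lin (r.root s) * divDiff r s F = polyAct (s : V ≃ₗ[ℂ] V) F - F := by
  have h := LinearEquiv.apply_symm_apply (LinearEquiv.ofInjective _ (mul_root_injective r s))
    (((polyAct (s : V ≃ₗ[ℂ] V)).toLinearMap - LinearMap.id).codRestrict
      (LinearMap.range (LinearMap.mulLeft ℂ (lin (r.root s))))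
      (root_act_sub_mem r s) F)
  exact congrArg Subtype.val h

lemma divDiff_mul (s : reflections W) (F G : Poly V) :
    divDiff r s (F * G) = divDiff r s F * G + polyAct (s : V ≃ₗ[ℂ] V) F * divDiff r s G := by
  apply mul_left_cancel₀ (lin_root_ne_zero r s)
  rw [root_mul_divDiff, mul_add, ← mul_assoc, root_mul_divDiff, mul_left_comm, root_mul_divDiff,
    map_mul]
  ring

/-- The Dunkl-Opdam operator
`∂_a + ∑ s ∈ S, 2 c_s / (1 - λ_s) * (α_s(a) / α_s) (s - 1)` on polynomial functions. -/
def dunkl (c : reflections W → ℂ) (a : V) : Poly V →ₗ[ℂ] Poly V :=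
  deriv a + ∑ᶠ s : reflections W, (2 * c s / (1 - r.eig s) * r.root s a) • divDiff r s

end Dunkl

/-! ### Functions on the formal neighbourhood of an orbit -/

section Orbit

variable (W : Subgroup (V ≃ₗ[ℂ] V)) (b : V)

/-- The ideal of polynomial functions vanishing on the `W`-orbit of `b`. -/
def orbitIdeal : Ideal (Poly V) := ⨅ w : W, RingHom.ker (evalAt ((w : V ≃ₗ[ℂ] V) b))

/-- The algebra of regular functions on the formal neighbourhood in `V` of the `W`-orbit of `b`
(for `b = 0` it is `ℂ[[V]]`). -/
abbrev FormalFun : Type _ := AdicCompletion (orbitIdeal W b) (Poly V)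

lemma evalAt_polyAct (w : V ≃ₗ[ℂ] V) (p : V) (F : Poly V) :
    evalAt p (polyAct w F) = evalAt (w⁻¹ p) F := by
  have h : (evalAt p).comp (polyAct w) = evalAt (w⁻¹ p) := by
    apply SymmetricAlgebra.algHom_ext
    ext α
    simp [evalAt, polyAct, dualAct]
  exact DFunLike.congr_fun h F

lemma polyAct_mem (u : W) {k : ℕ} {F : Poly V} (hF : F ∈ orbitIdeal W b ^ k) :
    polyAct (u : V ≃ₗ[ℂ] V) F ∈ orbitIdeal W b ^ k := by
  have h : orbitIdeal W b ≤ (orbitIdeal W b).comap (polyAct (u : V ≃ₗ[ℂ] V)) := by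
    intro G hG
    simp only [orbitIdeal, Ideal.mem_comap, Submodule.mem_iInf, RingHom.mem_ker] at hG ⊢
    intro w
    rw [evalAt_polyAct]
    exact hG (u⁻¹ * w)
  exact (Ideal.le_comap_pow (polyAct (u : V ≃ₗ[ℂ] V)) k) (Ideal.pow_right_mono h k hF)

/-- The operators on polynomial functions that lower the order of vanishing on the orbit by at most
one. -/
def shiftOps : Submodule ℂ (Poly V →ₗ[ℂ] Poly V) where
  carrier := {D | ∀ k, ∀ F ∈ orbitIdeal W b ^ (k + 1), D F ∈ orbitIdeal W b ^ k}
  add_mem' hD hE k F hF := add_mem (hD k F hF) (hE k F hF)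
  zero_mem' _ _ _ := zero_mem _
  smul_mem' t _ hD k F hF := Submodule.smul_of_tower_mem _ t (hD k F hF)

lemma mem_shiftOps_of_twisted (D : Poly V →ₗ[ℂ] Poly V) (u : W)
    (h : ∀ F G, D (F * G) = D F * G + polyAct (u : V ≃ₗ[ℂ] V) F * D G) : D ∈ shiftOps W b := by
  intro k
  induction k with
  | zero => intro F _; simp
  | succ k ih =>
    intro F hF
    rw [pow_succ] at hF
    refine Submodule.mul_induction_on hF (fun G hG K hK => ?_) (fun G K hG hK => ?_)
    · rw [h]
      refine add_mem ?_ (Ideal.mul_mem_right _ _ (polyAct_mem W b u hG))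
      rw [pow_succ]
      exact Ideal.mul_mem_mul (ih G hG) hK
    · rw [map_add]; exact add_mem hG hK

lemma polyAct_one : polyAct (1 : V ≃ₗ[ℂ] V) = AlgHom.id ℂ (Poly V) := by
  apply SymmetricAlgebra.algHom_ext
  ext α
  have : dualAct (1 : V ≃ₗ[ℂ] V) α = α := by ext v; simp [dualAct]
  simp [polyAct, this]

lemma polyAct_mul (u v : V ≃ₗ[ℂ] V) : polyAct (u * v) = (polyAct u).comp (polyAct v) := by
  apply SymmetricAlgebra.algHom_ext
  ext α
  have : dualAct (u * v) α = dualAct u (dualAct v α) := by ext; simp [dualAct]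
  simp [polyAct, this]

lemma deriv_mem_shiftOps (a : V) : deriv a ∈ shiftOps W b :=
  mem_shiftOps_of_twisted W b _ 1 fun F G => by simp [deriv_mul, polyAct_one]

lemma polyAct_mem_shiftOps (u : W) : (polyAct (u : V ≃ₗ[ℂ] V)).toLinearMap ∈ shiftOps W b :=
  fun k _ hF => polyAct_mem W b u (Ideal.pow_le_pow_right (Nat.le_succ k) hF)

variable {W} in
lemma dunkl_mem_shiftOps (r : Roots W) (c : reflections W → ℂ) (a : V) :
    dunkl r c a ∈ shiftOps W b :=
  add_mem (deriv_mem_shiftOps W b a)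
    (finsum_induction (· ∈ shiftOps W b) (zero_mem _) (fun _ _ => add_mem)
      fun s : reflections W =>
      Submodule.smul_mem _ _ (mem_shiftOps_of_twisted W b _ ⟨s, s.2.1⟩ (divDiff_mul r s)))

variable {W b}

/-- The map `ℂ[V]/J^(k+1) → ℂ[V]/J^k` induced by an operator in `shiftOps`. -/
def extendAux (D : shiftOps W b) (k : ℕ) :
    (Poly V ⧸ (orbitIdeal W b ^ (k + 1) • ⊤ : Submodule (Poly V) (Poly V))) →ₗ[ℂ]
      (Poly V ⧸ (orbitIdeal W b ^ k • ⊤ : Submodule (Poly V) (Poly V))) :=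
  (Submodule.Quotient.restrictScalarsEquiv ℂ _).toLinearMap ∘ₗ
    Submodule.mapQ _ ((orbitIdeal W b ^ k • ⊤ : Submodule (Poly V) (Poly V)).restrictScalars ℂ)
      (D : Poly V →ₗ[ℂ] Poly V) (fun F hF => by
        have := D.2 k F (by simpa using hF)
        simpa using this) ∘ₗ
    (Submodule.Quotient.restrictScalarsEquiv ℂ _).symm.toLinearMap

lemma extendAux_mk (D : shiftOps W b) (k : ℕ) (F : Poly V) :
    extendAux D k (Submodule.Quotient.mk F) = Submodule.Quotient.mk (D.1 F) := rfl

lemma transitionMap_extendAux (D : shiftOps W b) {m n : ℕ} (hmn : m ≤ n)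
    (x : Poly V ⧸ (orbitIdeal W b ^ (n + 1) • ⊤ : Submodule (Poly V) (Poly V))) :
    AdicCompletion.transitionMap (orbitIdeal W b) (Poly V) hmn (extendAux D n x) =
      extendAux D m (AdicCompletion.transitionMap (orbitIdeal W b) (Poly V)
        (Nat.succ_le_succ hmn) x) := by
  obtain ⟨G, rfl⟩ := Submodule.Quotient.mk_surjective _ x
  rfl

/-- The continuous extension of an operator in `shiftOps` to the formal neighbourhood of the
orbit. -/
def extend (D : shiftOps W b) : Module.End ℂ (FormalFun W b) where
  toFun F := ⟨fun k => extendAux D k (F.val (k + 1)), fun {m n} hmn =>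
    (transitionMap_extendAux D hmn (F.val (n + 1))).trans
      (congrArg (extendAux D m) (F.2 (Nat.succ_le_succ hmn)))⟩
  map_add' F G := AdicCompletion.ext fun k =>
    map_add (extendAux D k) (F.val (k + 1)) (G.val (k + 1))
  map_smul' t F := AdicCompletion.ext fun k =>
    map_smul (extendAux D k) t (F.val (k + 1))

/-- `extend D` agrees with `D` on polynomial functions. -/
lemma extend_of (D : shiftOps W b) (F : Poly V) :
    extend D (AdicCompletion.of _ _ F) = AdicCompletion.of _ _ (D.1 F) := rfl

variable (W b)

lemma extend_one (h : (polyAct ((1 : W) : V ≃ₗ[ℂ] V)).toLinearMap ∈ shiftOps W b) :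
    extend ⟨_, h⟩ = 1 := by
  have key (k : ℕ)
      (x : Poly V ⧸ (orbitIdeal W b ^ (k + 1) • ⊤ : Submodule (Poly V) (Poly V))) :
      extendAux ⟨_, h⟩ k x =
        AdicCompletion.transitionMap (orbitIdeal W b) (Poly V) (Nat.le_succ k) x := by
    obtain ⟨G, rfl⟩ := Submodule.Quotient.mk_surjective _ x
    rw [extendAux_mk]
    exact congrArg Submodule.Quotient.mk (DFunLike.congr_fun polyAct_one G)
  exact LinearMap.ext fun F => AdicCompletion.ext fun k =>
    (key k (F.val (k + 1))).trans (F.2 (Nat.le_succ k))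

variable {W b} in
lemma extend_mul (D E DE : shiftOps W b) (h : DE.1 = D.1 ∘ₗ E.1) :
    extend DE = extend D * extend E := by
  have key (k : ℕ)
      (x : Poly V ⧸ (orbitIdeal W b ^ (k + 1 + 1) • ⊤ : Submodule (Poly V) (Poly V))) :
      extendAux DE k (AdicCompletion.transitionMap (orbitIdeal W b) (Poly V)
        (Nat.le_succ (k + 1)) x) = extendAux D k (extendAux E (k + 1) x) := by
    obtain ⟨G, rfl⟩ := Submodule.Quotient.mk_surjective _ x
    rw [extendAux_mk, extendAux_mk]
    exact congrArg Submodule.Quotient.mk (DFunLike.congr_fun h G)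
  exact LinearMap.ext fun F => AdicCompletion.ext fun k =>
    (congrArg (extendAux DE k) (F.2 (Nat.le_succ (k + 1)))).symm.trans
      (key k (F.val (k + 1 + 1)))

/-- The action of `W` on functions on the formal neighbourhood of the orbit. -/
def formalAct : W →* Module.End ℂ (FormalFun W b) where
  toFun u := extend ⟨_, polyAct_mem_shiftOps W b u⟩
  map_one' := extend_one W b _
  map_mul' u v := extend_mul _ _ _
    (congrArg AlgHom.toLinearMap (polyAct_mul (u : V ≃ₗ[ℂ] V) (v : V ≃ₗ[ℂ] V)))

end Orbit

/-! ### The completion of `H_c(W, V)` at the image of `b` in `V / W` -/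

section Completion

variable {W : Subgroup (V ≃ₗ[ℂ] V)} (r : Roots W) (c : reflections W → ℂ) (b : V)

/-- The completion of `H_c(W, V)` at the image of `b` in `V / W`: the algebra of linear operators
on the functions on the formal neighbourhood of the orbit `W b` generated by these functions
(acting by multiplication), the group `W` and the Dunkl-Opdam operators. -/
def completion : Subalgebra ℂ (Module.End ℂ (FormalFun W b)) :=
  Algebra.adjoin ℂ
    (Set.range (LinearMap.mulLeft ℂ (A := FormalFun W b)) ∪ Set.range (formalAct W b) ∪
      Set.range fun a => extend ⟨dunkl r c a, dunkl_mem_shiftOps b r c a⟩)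

/-- A function on the formal neighbourhood, as an element of the completed algebra. -/
def completion.func (φ : FormalFun W b) : completion r c b :=
  ⟨LinearMap.mulLeft ℂ φ, Algebra.subset_adjoin (Or.inl (Or.inl ⟨φ, rfl⟩))⟩

/-- The group `W` in the completed algebra. -/
def completion.grp : W →* completion r c b :=
  (formalAct W b).codRestrict (completion r c b)
    fun u => Algebra.subset_adjoin (Or.inl (Or.inr ⟨u, rfl⟩))

/-- The Dunkl-Opdam operator of `a`, as an element of the completed algebra. -/
def completion.dunklOp (a : V) : completion r c b :=
  ⟨extend ⟨dunkl r c a, dunkl_mem_shiftOps b r c a⟩, Algebra.subset_adjoin (Or.inr ⟨a, rfl⟩)⟩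

/-- A linear form, as a function on the formal neighbourhood of the orbit of `b`. -/
def formalLin (W : Subgroup (V ≃ₗ[ℂ] V)) (b : V) (α : Dual ℂ V) : FormalFun W b :=
  AdicCompletion.of (orbitIdeal W b) (Poly V) (lin α)

/-- `ι` is the natural homomorphism from `H_c(W, V)` to its completion at `b`: it sends `w` to `w`,
`x_α` to multiplication by `α` and `y_a` to the Dunkl-Opdam operator of `a`. -/
def IsNatural (ι : Alg r c →ₐ[ℂ] completion r c b) : Prop :=
  (∀ w, ι (Alg.grp r c w) = completion.grp r c b w) ∧
  (∀ α, ι (Alg.x r c α) = completion.func r c b (formalLin W b α)) ∧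
  ∀ a, ι (Alg.y r c a) = completion.dunklOp r c b a

end Completion

/-! ### The centralizer construction -/

section Centralizer

variable {G H A : Type*} [Group G] [Group H] [Ring A] [Algebra ℂ A]

/-- The right `A`-module `P = Fun_H(G, A)` of functions `f : G → A` with `f (h g) = h f (g)`, for
`i : H →* G` and `j : H →* A`. -/
def funH (i : H →* G) (j : H →* A) : Submodule Aᵐᵒᵖ (G → A) where
  carrier := {f | ∀ h g, f (i h * g) = j h * f g}
  add_mem' hf hf' h g := by simp [hf h g, hf' h g, mul_add]
  zero_mem' h g := by simp
  smul_mem' a f hf h g := by simp [hf h g, mul_assoc]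

/-- The centralizer algebra `Z(G, H, A) = End_A(P)` of the right `A`-module `P = Fun_H(G, A)`. -/
abbrev centralizerAlg (i : H →* G) (j : H →* A) : Type _ := Module.End Aᵐᵒᵖ (funH i j)

end Centralizer

section Local

variable {W : Subgroup (V ≃ₗ[ℂ] V)} (r : Roots W) (c : reflections W → ℂ) (b : V)

/-- The completion at `0` of `H_{c'}(W_b, V)`, with `c'` the restriction of `c` to `W_b`. -/
abbrev localCompletion : Subalgebra ℂ (Module.End ℂ (FormalFun (pointStabilizer W b) 0)) :=
  completion (r.restrict (pointStabilizer_le W b)) (restrictParam (pointStabilizer_le W b) c) 0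

/-- The algebra `Z(W, W_b, A)` for `A` the completion at `0` of `H_{c'}(W_b, V)`. -/
abbrev localCentralizer : Type _ :=
  centralizerAlg (Subgroup.inclusion (pointStabilizer_le W b))
    (completion.grp (r.restrict (pointStabilizer_le W b))
      (restrictParam (pointStabilizer_le W b) c) 0)

/-- The power series `1 / (x_α + α(b))` in `ℂ[[V]]`, for `α(b) ≠ 0`. -/
def invShifted (W : Subgroup (V ≃ₗ[ℂ] V)) (b : V) (α : Dual ℂ V) :
    FormalFun (pointStabilizer W b) 0 :=
  Ring.inverse (formalLin (pointStabilizer W b) 0 α + algebraMap ℂ _ (α b))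

end Local

end

end Cherednik

namespace Cherednik

noncomputable section

open Module

variable {V : Type*} [AddCommGroup V] [Module ℂ V] {W : Subgroup (V ≃ₗ[ℂ] V)}

/-! ### Reflections -/

/-! The orbit `W b` is finite, so the Chinese remainder theorem splits the formal functions along it
into power series at its points. Translating the germ at `w⁻¹ b` to the origin by `w` identifies
these functions with the `W_b`-equivariant families `W → ℂ[[V]]` (`germ_ext`, `exists_germ_eq`). In
such families `W` acts by right translation and a function acts by its germs. In `D_a` the
reflections fixing `b` reassemble into the Dunkl operator of `W_b`, while for the others `α_s +
α_s(b)` is a unit of `ℂ[[V]]`, so their divided differences split into two separate terms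
(`germ_dunklOp`). Every generator therefore acts by coefficients in the local completed algebra `A`,
and the same formulas act on families with values in `A`. This defines the map to `End_A(P)`.

It is bijective because `End_A(P)` is a matrix algebra over `A` indexed by the cosets of `W_b`. The
completed algebra contains the translations, and cutting off with the idempotent function that is
`1` near `b` and `0` near the other points realises each element of `A` as a corner entry.
Translating corners produces all matrix units (`bijective_centralizerHom`).

The natural homomorphisms exist because Dunkl operators are equivariant and commute
(`polyAct_dunkl`, `dunkl_comm`). The identities are checked on polynomials and extended by
continuity. Uniqueness is not formal, since the images of the generators of `H_c` need not generate
the completed algebra and `θ` is not assumed continuous. It follows from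
`eq_id_of_fixes_generators`: the functions are the centralizer of the linear forms, and an
endomorphism of the completed algebra fixing the linear forms is automatically adically continuous
on them. -/

@[simp]
lemma dualAct_apply (w : V ≃ₗ[ℂ] V) (α : Dual ℂ V) (v : V) : dualAct w α v = α (w⁻¹ v) := rfl

lemma dualAct_mul (u v : V ≃ₗ[ℂ] V) (α : Dual ℂ V) :
    dualAct (u * v) α = dualAct u (dualAct v α) := by
  ext; simp

lemma dualAct_one (α : Dual ℂ V) : dualAct (1 : V ≃ₗ[ℂ] V) α = α := by
  ext; simp

@[simp]
lemma polyAct_lin (w : V ≃ₗ[ℂ] V) (α : Dual ℂ V) : polyAct w (lin α) = lin (dualAct w α) := by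
  simp [polyAct]

instance finite_reflections [Finite W] : Finite (reflections W) :=
  Finite.of_injective (fun s : reflections W => (⟨s, s.2.1⟩ : W)) fun s t h => by
    simpa [Subtype.ext_iff] using h

instance finite_pointStabilizer [Finite W] (b : V) : Finite (pointStabilizer W b) :=
  Finite.of_injective _ (Subgroup.inclusion_injective (pointStabilizer_le W b))

variable (r : Roots W)

/-- The difference `s⁻¹ v - v` lies in the line of the coroot. Evaluating the eigenvalue equation of
the root at `v` fixes the coefficient, the pairing `2` giving the denominator. -/
lemma refl_inv_apply (s : reflections W) (v : V) :
    (s : V ≃ₗ[ℂ] V)⁻¹ v = v - ((1 - r.eig s) / 2 * r.root s v) • r.coroot s := by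
  have h : (s : V ≃ₗ[ℂ] V)⁻¹ v - v ∈ Submodule.span ℂ {r.coroot s} := by
    rw [r.span_coroot s]
    refine ⟨-((s : V ≃ₗ[ℂ] V)⁻¹ v), ?_⟩
    simp [neg_add_eq_sub]
  obtain ⟨t, ht⟩ := Submodule.mem_span_singleton.1 h
  have h1 : (s : V ≃ₗ[ℂ] V)⁻¹ v = v + t • r.coroot s := by rw [ht]; abel
  have h2 := LinearMap.congr_fun (r.eig_spec s) v
  rw [dualAct_apply, h1, map_add, map_smul, r.pairing] at h2
  simp only [smul_eq_mul, LinearMap.smul_apply] at h2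
  have h3 : t = -((1 - r.eig s) / 2 * r.root s v) := by linear_combination h2 / 2
  rw [h1, h3]
  module

lemma dualAct_refl (s : reflections W) (α : Dual ℂ V) :
    dualAct (s : V ≃ₗ[ℂ] V) α = α - ((1 - r.eig s) / 2 * α (r.coroot s)) • r.root s := by
  ext v
  simp only [dualAct_apply, refl_inv_apply r s v, map_sub, map_smul, smul_eq_mul,
    LinearMap.sub_apply, LinearMap.smul_apply]
  ring

/-- For `λ_s = 1` the reflection formula would give `s = 1`. Hence the divisions by `1 - λ_s` are
genuine. -/
lemma one_sub_eig_ne_zero (s : reflections W) : 1 - r.eig s ≠ 0 := by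
  intro h
  refine s.2.2.1 (inv_eq_one.1 ?_)
  ext v
  simp [refl_inv_apply r s v, h]

lemma refl_apply_eq_self_iff (s : reflections W) (v : V) :
    (s : V ≃ₗ[ℂ] V) v = v ↔ r.root s v = 0 := by
  have h : (s : V ≃ₗ[ℂ] V) v = v ↔ (s : V ≃ₗ[ℂ] V)⁻¹ v = v := by
    constructor
    · intro h
      exact (LinearEquiv.symm_apply_eq (s : V ≃ₗ[ℂ] V)).2 h.symm
    · intro h
      exact ((LinearEquiv.symm_apply_eq (s : V ≃ₗ[ℂ] V)).1 h).symm
  have h0 : r.coroot s ≠ 0 := by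
    intro h
    have := r.pairing s
    simp [h] at this
  rw [h, refl_inv_apply r s v, sub_eq_self, smul_eq_zero, or_iff_left h0, mul_eq_zero,
    or_iff_right (div_ne_zero (one_sub_eig_ne_zero r s) two_ne_zero)]

/-- Conjugation by `w ∈ W` on the reflections of `W`. -/
def conjRefl (w : W) : reflections W ≃ reflections W :=
  have mem (w : W) (s : reflections W) :
      (w : V ≃ₗ[ℂ] V) * s * (w : V ≃ₗ[ℂ] V)⁻¹ ∈ reflections W := by
    refine ⟨W.mul_mem (W.mul_mem w.2 s.2.1) (W.inv_mem w.2), ?_, ?_⟩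
    · intro h
      exact s.2.2.1 (by simpa using conj_eq_one_iff.1 h)
    · have h : ((w : V ≃ₗ[ℂ] V) * s * (w : V ≃ₗ[ℂ] V)⁻¹).toLinearMap - LinearMap.id =
          (w : V ≃ₗ[ℂ] V).toLinearMap ∘ₗ ((s : V ≃ₗ[ℂ] V).toLinearMap - LinearMap.id) ∘ₗ
            ((w : V ≃ₗ[ℂ] V)⁻¹).toLinearMap := by
        ext v
        simp
      rw [h, LinearMap.range_comp, LinearMap.range_comp_of_range_eq_top _ (LinearEquiv.range _),
        LinearEquiv.finrank_map_eq]
      exact s.2.2.2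
  { toFun s := ⟨_, mem w s⟩
    invFun s := ⟨_, mem w⁻¹ s⟩
    left_inv s := by ext1; simp [mul_assoc]
    right_inv s := by ext1; simp [mul_assoc] }

lemma coe_conjRefl (w : W) (s : reflections W) :
    (conjRefl w s : V ≃ₗ[ℂ] V) = (w : V ≃ₗ[ℂ] V) * s * (w : V ≃ₗ[ℂ] V)⁻¹ := rfl

/-- The roots are chosen independently for each reflection, so conjugation respects them only up to
a scalar. Pulling the root of `w s w⁻¹` back by `w` gives an eigenvector of `s` with eigenvalue
different from `1`, which must be proportional to `α_s`. -/
lemma root_conjRefl (w : W) (s : reflections W) :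
    ∃ k : ℂ, k ≠ 0 ∧ r.root (conjRefl w s) = k • dualAct (w : V ≃ₗ[ℂ] V) (r.root s) ∧
      r.eig (conjRefl w s) = r.eig s := by
  set t := conjRefl w s with ht
  set β := dualAct (w : V ≃ₗ[ℂ] V)⁻¹ (r.root t) with hβ
  have hw : dualAct (w : V ≃ₗ[ℂ] V) β = r.root t := by
    rw [hβ, ← dualAct_mul, mul_inv_cancel, dualAct_one]
  have h1 : dualAct (s : V ≃ₗ[ℂ] V) β = r.eig t • β := by
    have := congrArg (dualAct (w : V ≃ₗ[ℂ] V)⁻¹) (r.eig_spec t)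
    rw [map_smul, ← hβ, ht, coe_conjRefl, dualAct_mul, dualAct_mul, ← dualAct_mul (_)⁻¹,
      inv_mul_cancel, dualAct_one, ← ht, ← hβ] at this
    exact this
  have h2 := dualAct_refl r s β
  rw [h1] at h2
  set k := (1 - r.eig t)⁻¹ * ((1 - r.eig s) / 2 * β (r.coroot s)) with hk
  have h3 : β = k • r.root s := by
    have : (1 - r.eig t) • β = ((1 - r.eig s) / 2 * β (r.coroot s)) • r.root s := by
      rw [sub_smul, one_smul, h2]; abel
    rw [hk, mul_smul, ← this, smul_smul, inv_mul_cancel₀ (one_sub_eig_ne_zero r t), one_smul]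
  have hk0 : k ≠ 0 := by
    intro h0
    apply root_ne_zero r t
    rw [← hw, h3, h0]
    simp
  refine ⟨k, hk0, by rw [← hw, h3, map_smul], ?_⟩
  rw [h3, map_smul, r.eig_spec, smul_smul, smul_smul] at h1
  have := smul_left_injective ℂ (root_ne_zero r s) h1
  exact (mul_left_cancel₀ hk0 (by rw [this, mul_comm])).symm

/-! ### Dunkl operators on polynomial functions -/

lemma deriv_algebraMap (a : V) (t : ℂ) : deriv a (algebraMap ℂ _ t) = 0 := by
  simp [deriv, TrivSqZeroExt.algebraMap_eq_inl']

lemma deriv_add_left (a a' : V) (F : Poly V) : deriv (a + a') F = deriv a F + deriv a' F := by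
  induction F using SymmetricAlgebra.induction with
  | algebraMap t => simp [deriv_algebraMap]
  | ι α => simp only [deriv_lin, map_add]
  | mul F G hF hG => simp only [deriv_mul, hF, hG]; ring
  | add F G hF hG => simp only [map_add, hF, hG]; ring

lemma deriv_smul_left (t : ℂ) (a : V) (F : Poly V) : deriv (t • a) F = t • deriv a F := by
  induction F using SymmetricAlgebra.induction with
  | algebraMap t => simp [deriv_algebraMap]
  | ι α => simp only [deriv_lin, map_smul, smul_eq_mul, map_mul, Algebra.smul_def]
  | mul F G hF hG => simp only [deriv_mul, hF, hG, smul_add, smul_mul_assoc, mul_smul_comm]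
  | add F G hF hG => simp only [map_add, hF, hG, smul_add]

lemma polyAct_deriv (w : V ≃ₗ[ℂ] V) (a : V) (F : Poly V) :
    polyAct w (deriv a F) = deriv (w a) (polyAct w F) := by
  induction F using SymmetricAlgebra.induction with
  | algebraMap t => simp [deriv_algebraMap]
  | ι α =>
    have : w⁻¹ (w a) = a := LinearEquiv.symm_apply_apply _ _
    simp [deriv_lin, this]
  | mul F G hF hG => simp only [deriv_mul, map_mul, map_add, hF, hG]
  | add F G hF hG => simp only [map_add, hF, hG]

lemma divDiff_lin (s : reflections W) (α : Dual ℂ V) :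
    divDiff r s (lin α) = algebraMap ℂ _ (-((1 - r.eig s) / 2 * α (r.coroot s))) := by
  apply mul_left_cancel₀ (lin_root_ne_zero r s)
  rw [root_mul_divDiff, polyAct_lin, dualAct_refl r s, mul_comm (lin _),
    ← Algebra.smul_def, neg_smul]
  simp [lin]

lemma divDiff_algebraMap (s : reflections W) (t : ℂ) : divDiff r s (algebraMap ℂ _ t) = 0 := by
  apply mul_left_cancel₀ (lin_root_ne_zero r s)
  simp [root_mul_divDiff]

/-- The factor `α_s(a)` is kept because `α_s(a) / α_s` does not change when the root is rescaled, so
the unknown scalar of `root_conjRefl` cancels. -/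
lemma polyAct_divDiff (w : W) (s : reflections W) (a : V) (F : Poly V) :
    r.root s a • polyAct (w : V ≃ₗ[ℂ] V) (divDiff r s F) =
      r.root (conjRefl w s) ((w : V ≃ₗ[ℂ] V) a) •
        divDiff r (conjRefl w s) (polyAct (w : V ≃ₗ[ℂ] V) F) := by
  obtain ⟨k, hk, h, -⟩ := root_conjRefl r w s
  have h1 : lin (r.root (conjRefl w s)) = k • polyAct (w : V ≃ₗ[ℂ] V) (lin (r.root s)) := by
    rw [h, polyAct_lin, lin, map_smul]
  have h2 : r.root (conjRefl w s) ((w : V ≃ₗ[ℂ] V) a) = k * r.root s a := by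
    have : (w : V ≃ₗ[ℂ] V)⁻¹ ((w : V ≃ₗ[ℂ] V) a) = a := LinearEquiv.symm_apply_apply _ _
    simp [h, this]
  have h3 : polyAct (conjRefl w s : V ≃ₗ[ℂ] V) (polyAct (w : V ≃ₗ[ℂ] V) F) =
      polyAct (w : V ≃ₗ[ℂ] V) (polyAct (s : V ≃ₗ[ℂ] V) F) := by
    rw [← AlgHom.comp_apply, ← AlgHom.comp_apply, ← polyAct_mul, ← polyAct_mul, coe_conjRefl,
      inv_mul_cancel_right]
  apply mul_left_cancel₀ (lin_root_ne_zero r (conjRefl w s))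
  rw [mul_smul_comm, mul_smul_comm, root_mul_divDiff, h1, h3, h2, smul_mul_assoc, ← map_mul,
    root_mul_divDiff, map_sub, smul_smul, mul_comm]

variable (c : reflections W → ℂ)

section Finite

variable [Fintype (reflections W)]

lemma dunkl_apply (a : V) (F : Poly V) : dunkl r c a F =
    deriv a F + ∑ s, (2 * c s / (1 - r.eig s) * r.root s a) • divDiff r s F := by
  simp [dunkl, finsum_eq_sum_of_fintype]

lemma dunkl_add_left (a a' : V) : dunkl r c (a + a') = dunkl r c a + dunkl r c a' := by
  ext1 F
  simp only [LinearMap.add_apply, dunkl_apply, deriv_add_left, map_add, mul_add, add_smul,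
    Finset.sum_add_distrib]
  abel

lemma dunkl_smul_left (t : ℂ) (a : V) : dunkl r c (t • a) = t • dunkl r c a := by
  ext1 F
  simp only [LinearMap.smul_apply, dunkl_apply, deriv_smul_left, map_smul, smul_add,
    Finset.smul_sum, smul_smul, smul_eq_mul]
  congr! 3
  ring

lemma dunkl_algebraMap (a : V) (t : ℂ) : dunkl r c a (algebraMap ℂ _ t) = 0 := by
  simp [dunkl_apply, deriv_algebraMap, divDiff_algebraMap]

/-- This is the relation for `[y, x]` as an identity of operators. In the twisted Leibniz rule `(s α
- α) / α_s` is the scalar `-(1 - λ_s) α(α_s^∨) / 2`, which cancels the normalisation `2 / (1 -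
λ_s)`. -/
lemma dunkl_lin_mul (a : V) (α : Dual ℂ V) (F : Poly V) :
    dunkl r c a (lin α * F) = lin α * dunkl r c a F + (α a • F -
      ∑ s : reflections W, (c s * r.root s a * α (r.coroot s)) • polyAct (s : V ≃ₗ[ℂ] V) F) := by
  have h (s : reflections W) :
      (2 * c s / (1 - r.eig s) * r.root s a) • divDiff r s (lin α * F) =
        lin α * ((2 * c s / (1 - r.eig s) * r.root s a) • divDiff r s F) -
          (c s * r.root s a * α (r.coroot s)) • polyAct (s : V ≃ₗ[ℂ] V) F := by
    have hs := one_sub_eig_ne_zero r s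
    have hk : 2 * c s / (1 - r.eig s) * r.root s a * -((1 - r.eig s) / 2 * α (r.coroot s)) =
        -(c s * r.root s a * α (r.coroot s)) := by field_simp
    rw [mul_comm (lin α) F, divDiff_mul, divDiff_lin, mul_comm (polyAct _ _),
      ← Algebra.smul_def, smul_add, smul_smul, mul_comm _ (lin α), mul_smul_comm, hk, neg_smul,
      ← sub_eq_add_neg]
  simp only [dunkl_apply, h, deriv_mul, deriv_lin, Finset.sum_sub_distrib, mul_add,
    Finset.mul_sum, Algebra.smul_def]
  ring

variable {c}

lemma polyAct_dunkl (hc : IsInvariant c) (w : W) (a : V) (F : Poly V) :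
    polyAct (w : V ≃ₗ[ℂ] V) (dunkl r c a F) =
      dunkl r c ((w : V ≃ₗ[ℂ] V) a) (polyAct (w : V ≃ₗ[ℂ] V) F) := by
  simp only [dunkl_apply, map_add, map_sum, map_smul, polyAct_deriv]
  congr 1
  refine Fintype.sum_equiv (conjRefl w) _ _ fun s => ?_
  obtain ⟨-, -, -, he⟩ := root_conjRefl r w s
  rw [he, hc s (conjRefl w s) w w.2 rfl, mul_smul, mul_smul, polyAct_divDiff]

/-- The commutator of two Dunkl operators commutes with multiplication by linear forms, hence by all
polynomials, and it kills `1`; so it vanishes. -/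
lemma dunkl_comm (hc : IsInvariant c) (a a' : V) (F : Poly V) :
    dunkl r c a (dunkl r c a' F) = dunkl r c a' (dunkl r c a F) := by
  -- The failure of `s` to commute with `D_a` is `α_s(a)` times an operator that does not depend on
  -- `a`.
  have hs (s : reflections W) (a : V) (F : Poly V) :
      polyAct (s : V ≃ₗ[ℂ] V) (dunkl r c a F) = dunkl r c a (polyAct (s : V ≃ₗ[ℂ] V) F) +
        ((1 - r.eig s) / 2 * r.root s a) • polyAct (s : V ≃ₗ[ℂ] V)
          (dunkl r c (r.coroot s) F) := by
    have h1 := polyAct_dunkl r hc ⟨s, s.2.1⟩ ((s : V ≃ₗ[ℂ] V)⁻¹ a) F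
    have h2 : ((⟨s, s.2.1⟩ : W) : V ≃ₗ[ℂ] V) ((s : V ≃ₗ[ℂ] V)⁻¹ a) = a :=
      LinearEquiv.apply_symm_apply _ _
    have h3 : dunkl r c ((s : V ≃ₗ[ℂ] V)⁻¹ a) = dunkl r c a +
        (-((1 - r.eig s) / 2 * r.root s a)) • dunkl r c (r.coroot s) := by
      rw [refl_inv_apply r s, sub_eq_add_neg, ← neg_smul, dunkl_add_left, dunkl_smul_left]
    rw [h2, h3] at h1
    simp only [LinearMap.add_apply, LinearMap.smul_apply, map_add, map_smul] at h1
    rw [← h1]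
    module
  -- Only this shape matters below, so the operator is made opaque.
  obtain ⟨T, hT⟩ : ∃ T : reflections W → Poly V → Poly V,
      ∀ (s : reflections W) a F,
      polyAct (s : V ≃ₗ[ℂ] V) (dunkl r c a F) = dunkl r c a (polyAct (s : V ≃ₗ[ℂ] V) F) +
        ((1 - r.eig s) / 2 * r.root s a) • T s F := ⟨_, hs⟩
  set C : Poly V →ₗ[ℂ] Poly V := dunkl r c a ∘ₗ dunkl r c a' - dunkl r c a' ∘ₗ dunkl r c a with hC
  have hlin (α : Dual ℂ V) (F : Poly V) : C (lin α * F) = lin α * C F := by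
    simp only [hC, LinearMap.sub_apply, LinearMap.comp_apply, dunkl_lin_mul, map_add, map_sub,
      map_sum, map_smul, mul_sub, hT, smul_add, Finset.sum_add_distrib, smul_smul]
    -- The correction terms contain `α_s(a) α_s(a')`, symmetric in `a` and `a'`, and drop out of the
    -- commutator.
    have : ∑ s, (c s * r.root s a * α (r.coroot s) * ((1 - r.eig s) / 2 * r.root s a')) • T s F =
        ∑ s, (c s * r.root s a' * α (r.coroot s) * ((1 - r.eig s) / 2 * r.root s a)) • T s F := by
      congr! 2
      ring
    rw [this]
    abel
  have hmul (G : Poly V) : ∀ F, C (G * F) = G * C F := by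
    induction G using SymmetricAlgebra.induction with
    | algebraMap t => intro F; simp only [← Algebra.smul_def, map_smul]
    | ι α => exact hlin α
    | mul G K hG hK => intro F; rw [mul_assoc, hG, hK, mul_assoc]
    | add G K hG hK => intro F; rw [add_mul, map_add, hG, hK, add_mul]
  have h1 : C 1 = 0 := by
    have h0 (a : V) : dunkl r c a 1 = 0 := by simpa using dunkl_algebraMap r c a 1
    simp [hC, h0]
  have := hmul F 1
  rw [h1, mul_zero, mul_one] at this
  exact sub_eq_zero.1 this

end Finite

end

end Cherednik

namespace Cherednik

noncomputable section

open Module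

variable {V : Type*} [AddCommGroup V] [Module ℂ V] {W : Subgroup (V ≃ₗ[ℂ] V)}

/-! ### Continuous maps between adic completions -/

section Continuity

variable {I J K : Ideal (Poly V)}

lemma of_mul (F G : Poly V) :
    AdicCompletion.of I (Poly V) (F * G) = AdicCompletion.of I _ F * AdicCompletion.of I _ G := rfl

lemma of_one : AdicCompletion.of I (Poly V) 1 = 1 := rfl

lemma of_algebraMap (t : ℂ) :
    AdicCompletion.of I (Poly V) (algebraMap ℂ _ t) = algebraMap ℂ _ t := rfl

lemma of_smul (t : ℂ) (F : Poly V) :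
    AdicCompletion.of I (Poly V) (t • F) = t • AdicCompletion.of I _ F := rfl

lemma of_val_eq_zero_iff {F : Poly V} {k : ℕ} :
    (AdicCompletion.of I (Poly V) F).val k = 0 ↔ F ∈ I ^ k := by
  rw [AdicCompletion.of_apply, Submodule.mkQ_apply, Submodule.Quotient.mk_eq_zero]
  simp

lemma exists_of_val_eq (φ : AdicCompletion I (Poly V)) (k : ℕ) :
    ∃ F : Poly V, φ.val k = (AdicCompletion.of I (Poly V) F).val k := by
  obtain ⟨F, hF⟩ := Submodule.Quotient.mk_surjective _ (φ.val k)
  exact ⟨F, hF.symm⟩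

lemma val_eq_of_le {φ ψ : AdicCompletion I (Poly V)} {m n : ℕ} (hmn : m ≤ n)
    (h : φ.val n = ψ.val n) : φ.val m = ψ.val m := by
  have h1 : AdicCompletion.transitionMap I (Poly V) hmn (φ.val n) = φ.val m := φ.2 hmn
  have h2 : AdicCompletion.transitionMap I (Poly V) hmn (ψ.val n) = ψ.val m := ψ.2 hmn
  rw [← h1, ← h2, h]

/-- Continuity of a map between completions, with a uniform bound for the loss of precision. -/
def IsAdicContinuous (T : AdicCompletion I (Poly V) → AdicCompletion J (Poly V)) : Prop :=
  ∃ d, ∀ k φ ψ, φ.val (k + d) = ψ.val (k + d) → (T φ).val k = (T ψ).val k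

namespace IsAdicContinuous

variable {T T' : AdicCompletion I (Poly V) → AdicCompletion J (Poly V)}

lemma const (ψ : AdicCompletion J (Poly V)) :
    IsAdicContinuous fun _ : AdicCompletion I (Poly V) => ψ :=
  ⟨0, fun _ _ _ _ => rfl⟩

lemma id : IsAdicContinuous fun φ : AdicCompletion I (Poly V) => φ :=
  ⟨0, fun _ _ _ h => h⟩

lemma add (h : IsAdicContinuous T) (h' : IsAdicContinuous T') :
    IsAdicContinuous fun φ => T φ + T' φ := by
  obtain ⟨d, h⟩ := h
  obtain ⟨d', h'⟩ := h'
  refine ⟨d + d', fun k φ ψ e => ?_⟩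
  rw [AdicCompletion.val_add_apply, AdicCompletion.val_add_apply,
    h k φ ψ (val_eq_of_le (by omega) e), h' k φ ψ (val_eq_of_le (by omega) e)]

lemma sub (h : IsAdicContinuous T) (h' : IsAdicContinuous T') :
    IsAdicContinuous fun φ => T φ - T' φ := by
  obtain ⟨d, h⟩ := h
  obtain ⟨d', h'⟩ := h'
  refine ⟨d + d', fun k φ ψ e => ?_⟩
  rw [AdicCompletion.val_sub_apply, AdicCompletion.val_sub_apply,
    h k φ ψ (val_eq_of_le (by omega) e), h' k φ ψ (val_eq_of_le (by omega) e)]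

lemma smul (h : IsAdicContinuous T) (t : ℂ) : IsAdicContinuous fun φ => t • T φ := by
  obtain ⟨d, h⟩ := h
  refine ⟨d, fun k φ ψ e => ?_⟩
  rw [AdicCompletion.val_smul_apply, AdicCompletion.val_smul_apply, h k φ ψ e]

lemma mul (h : IsAdicContinuous T) (h' : IsAdicContinuous T') :
    IsAdicContinuous fun φ => T φ * T' φ := by
  obtain ⟨d, h⟩ := h
  obtain ⟨d', h'⟩ := h'
  refine ⟨d + d', fun k φ ψ e => ?_⟩
  rw [AdicCompletion.val_mul, AdicCompletion.val_mul,
    h k φ ψ (val_eq_of_le (by omega) e), h' k φ ψ (val_eq_of_le (by omega) e)]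

lemma sum {ι : Type*} (s : Finset ι)
    {T : ι → AdicCompletion I (Poly V) → AdicCompletion J (Poly V)}
    (h : ∀ i, IsAdicContinuous (T i)) : IsAdicContinuous fun φ => ∑ i ∈ s, T i φ := by
  classical
  induction s using Finset.induction_on with
  | empty => simp only [Finset.sum_empty]; exact const 0
  | insert i s hi ih => simp only [Finset.sum_insert hi]; exact (h i).add ih

lemma comp {S : AdicCompletion J (Poly V) → AdicCompletion K (Poly V)} (hS : IsAdicContinuous S)
    (h : IsAdicContinuous T) : IsAdicContinuous fun φ => S (T φ) := by
  obtain ⟨d, h⟩ := h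
  obtain ⟨e, hS⟩ := hS
  exact ⟨e + d, fun k φ ψ hφ => hS k _ _ (h _ φ ψ (by rwa [add_assoc]))⟩

/-- Continuous maps that agree on polynomials are equal. -/
lemma ext (h : IsAdicContinuous T) (h' : IsAdicContinuous T')
    (hF : ∀ F, T (AdicCompletion.of I _ F) = T' (AdicCompletion.of I _ F))
    (φ : AdicCompletion I (Poly V)) : T φ = T' φ := by
  obtain ⟨d, h⟩ := h
  obtain ⟨d', h'⟩ := h'
  refine AdicCompletion.ext fun k => ?_
  obtain ⟨F, hφ⟩ := exists_of_val_eq φ (k + (d + d'))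
  rw [h k _ _ (val_eq_of_le (by omega) hφ), hF, h' k _ _ (val_eq_of_le (by omega) hφ)]

lemma extend {b : V} (D : shiftOps W b) : IsAdicContinuous (extend D) :=
  ⟨1, fun k _ _ h => congrArg (extendAux D k) h⟩

end IsAdicContinuous

end Continuity

/-! ### The natural homomorphism to the completed algebra -/

section Completion

variable {r : Roots W} {c : reflections W → ℂ} {b : V}

/-- Each generator loses at most one order of vanishing, and finite sums and products keep the loss
bounded. Elements of the completed algebra are thus determined by their values on polynomials. -/
lemma isAdicContinuous_of_mem_completion {T : Module.End ℂ (FormalFun W b)}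
    (hT : T ∈ completion r c b) : IsAdicContinuous T := by
  induction hT using Algebra.adjoin_induction with
  | mem T hT =>
    obtain ((⟨φ, rfl⟩ | ⟨u, rfl⟩) | ⟨a, rfl⟩) := hT
    · exact (IsAdicContinuous.const φ).mul .id
    · exact .extend _
    · exact .extend _
  | algebraMap t => exact IsAdicContinuous.id.smul t
  | add T T' _ _ h h' => exact h.add h'
  | mul T T' _ _ h h' => exact h.comp h'

lemma isAdicContinuous_coe (T : completion r c b) : IsAdicContinuous T.1 :=
  isAdicContinuous_of_mem_completion T.2

lemma completion_ext {T T' : completion r c b}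
    (h : ∀ F, T.1 (AdicCompletion.of _ _ F) = T'.1 (AdicCompletion.of _ _ F)) : T = T' :=
  Subtype.ext (LinearMap.ext ((isAdicContinuous_coe T).ext (isAdicContinuous_coe T') h))

lemma func_of (G F : Poly V) :
    (completion.func r c b (AdicCompletion.of _ _ G)).1 (AdicCompletion.of _ _ F) =
      AdicCompletion.of _ _ (G * F) := rfl

lemma grp_of (w : W) (F : Poly V) :
    (completion.grp r c b w).1 (AdicCompletion.of _ _ F) =
      AdicCompletion.of _ _ (polyAct (w : V ≃ₗ[ℂ] V) F) := rfl

lemma dunklOp_of (a : V) (F : Poly V) :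
    (completion.dunklOp r c b a).1 (AdicCompletion.of _ _ F) =
      AdicCompletion.of _ _ (dunkl r c a F) := rfl

lemma grp_mul_dunklOp [Finite W] (hc : IsInvariant c) (w : W) (a : V) :
    completion.grp r c b w * completion.dunklOp r c b a =
      completion.dunklOp r c b ((w : V ≃ₗ[ℂ] V) a) * completion.grp r c b w := by
  have := Fintype.ofFinite (reflections W)
  refine completion_ext fun F => ?_
  rw [MulMemClass.coe_mul, MulMemClass.coe_mul, Module.End.mul_apply, Module.End.mul_apply,
    dunklOp_of, grp_of, grp_of, dunklOp_of, polyAct_dunkl r hc]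

variable (r c b) in
/-- The images of the generators of `H_c(W, V)` in its completion at `b`. -/
def genMap : Gen W → completion r c b
  | .grp w => completion.grp r c b w
  | .x α => completion.func r c b (formalLin W b α)
  | .y a => completion.dunklOp r c b a

lemma genMap_rel [Finite W] (hc : IsInvariant c) {p q : FreeAlgebra ℂ (Gen W)}
    (h : Rel r c p q) :
    FreeAlgebra.lift ℂ (genMap r c b) p = FreeAlgebra.lift ℂ (genMap r c b) q := by
  have := Fintype.ofFinite (reflections W)
  induction h with
  | grp_one => simp [genMap]
  | grp_mul u v => simp [genMap]
  | x_add α β =>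
    simp only [FreeAlgebra.lift_ι_apply, genMap, map_add]
    exact completion_ext fun F => by
      simp [formalLin, lin, completion.func, add_mul]
  | x_smul t α =>
    simp only [FreeAlgebra.lift_ι_apply, genMap, map_smul]
    exact completion_ext fun F => by
      simp [formalLin, lin, completion.func]
  | y_add a a' =>
    simp only [FreeAlgebra.lift_ι_apply, genMap, map_add]
    exact completion_ext fun F => by
      simp [dunklOp_of, dunkl_add_left]
  | y_smul t a =>
    simp only [FreeAlgebra.lift_ι_apply, genMap, map_smul]
    exact completion_ext fun F => by
      simp [dunklOp_of, dunkl_smul_left]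
  | grp_x w α =>
    simp only [FreeAlgebra.lift_ι_apply, genMap, map_mul]
    exact completion_ext fun F => by
      simp [formalLin, func_of, grp_of]
  | grp_y w a =>
    simp only [FreeAlgebra.lift_ι_apply, genMap, map_mul]
    exact grp_mul_dunklOp hc w a
  | x_comm α β =>
    simp only [FreeAlgebra.lift_ι_apply, genMap, map_mul]
    exact completion_ext fun F => by
      simp [formalLin, func_of, mul_left_comm]
  | y_comm a a' =>
    simp only [FreeAlgebra.lift_ι_apply, genMap, map_mul]
    exact completion_ext fun F => by
      simp [dunklOp_of, dunkl_comm r hc a a']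
  | y_x a α =>
    simp only [FreeAlgebra.lift_ι_apply, genMap, map_mul, map_sub, finsum_eq_sum_of_fintype,
      map_sum, map_smul, AlgHom.commutes]
    refine completion_ext fun F => ?_
    simp [formalLin, func_of, dunklOp_of, grp_of, dunkl_lin_mul, LinearMap.sum_apply]

variable (r b) in
/-- The natural homomorphism from `H_c(W, V)` to its completion at `b`. -/
def naturalHom [Finite W] (hc : IsInvariant c) : Alg r c →ₐ[ℂ] completion r c b :=
  RingQuot.liftAlgHom ℂ ⟨FreeAlgebra.lift ℂ (genMap r c b), fun _ _ h => genMap_rel hc h⟩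

lemma isNatural_naturalHom [Finite W] (hc : IsInvariant c) :
    IsNatural r c b (naturalHom r b hc) := by
  refine ⟨fun w => ?_, fun α => ?_, fun a => ?_⟩ <;>
  simp [naturalHom, Alg.grp, Alg.x, Alg.y, genMap]

end Completion

end

end Cherednik

namespace Cherednik

noncomputable section

open Module

variable {V : Type*} [AddCommGroup V] [Module ℂ V] {W : Subgroup (V ≃ₗ[ℂ] V)}

/-! ### Translations and ideals of points -/

/-- Translation of polynomial functions: `F(v) ↦ F(v + p)`. -/
def polyShift (p : V) : Poly V →ₐ[ℂ] Poly V :=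
  SymmetricAlgebra.lift (SymmetricAlgebra.ι ℂ (Dual ℂ V) +
    Algebra.linearMap ℂ (Poly V) ∘ₗ Dual.eval ℂ V p)

lemma polyShift_lin (p : V) (α : Dual ℂ V) :
    polyShift p (lin α) = lin α + algebraMap ℂ _ (α p) := by
  simp [polyShift]

lemma evalAt_lin (p : V) (α : Dual ℂ V) : evalAt p (lin α) = α p := by
  simp [evalAt]

lemma evalAt_polyShift (p q : V) (F : Poly V) : evalAt q (polyShift p F) = evalAt (q + p) F := by
  have h : (evalAt q).comp (polyShift p) = evalAt (q + p) := by
    apply SymmetricAlgebra.algHom_ext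
    ext α
    simp [evalAt, polyShift]
  exact DFunLike.congr_fun h F

lemma polyShift_polyShift_neg (p : V) (F : Poly V) : polyShift p (polyShift (-p) F) = F := by
  have h : (polyShift p).comp (polyShift (-p)) = AlgHom.id ℂ (Poly V) := by
    apply SymmetricAlgebra.algHom_ext
    ext α
    simp [polyShift]
  exact DFunLike.congr_fun h F

lemma polyShift_polyAct (w : V ≃ₗ[ℂ] V) (p : V) (F : Poly V) :
    polyShift (w p) (polyAct w F) = polyAct w (polyShift p F) := by
  have h : (polyShift (w p)).comp (polyAct w) = (polyAct w).comp (polyShift p) := by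
    apply SymmetricAlgebra.algHom_ext
    ext α
    simp [polyShift, polyAct]
  exact DFunLike.congr_fun h F

lemma polyShift_deriv (a p : V) (F : Poly V) :
    polyShift p (deriv a F) = deriv a (polyShift p F) := by
  induction F using SymmetricAlgebra.induction with
  | algebraMap t => simp [deriv_algebraMap]
  | ι α => simp [deriv_lin, polyShift_lin, deriv_algebraMap]
  | mul F G hF hG => simp only [deriv_mul, map_mul, map_add, hF, hG]
  | add F G hF hG => simp only [map_add, hF, hG]

/-- The ideal of polynomial functions vanishing at `p`. -/
abbrev pointIdeal (p : V) : Ideal (Poly V) := RingHom.ker (evalAt p)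

lemma orbitIdeal_zero : orbitIdeal W (0 : V) = pointIdeal 0 := by
  simp [orbitIdeal]

/-- A linear form `α` separates the two points, and `α - α(p)` and `α - α(q)` differ by a nonzero
constant. -/
lemma isCoprime_pointIdeal {p q : V} (h : p ≠ q) : IsCoprime (pointIdeal p) (pointIdeal q) := by
  obtain ⟨α, hα⟩ : ∃ α : Dual ℂ V, α (p - q) ≠ 0 := by
    by_contra! h0
    exact h (sub_eq_zero.1 ((Module.forall_dual_apply_eq_zero_iff ℂ _).1 h0))
  rw [map_sub] at hα
  rw [Ideal.isCoprime_iff_exists]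
  refine ⟨(α q - α p)⁻¹ • (lin α - algebraMap ℂ _ (α p)), ?_,
    (α p - α q)⁻¹ • (lin α - algebraMap ℂ _ (α q)), ?_, ?_⟩
  · simp [RingHom.mem_ker, evalAt_lin]
  · simp [RingHom.mem_ker, evalAt_lin]
  · rw [← neg_sub (α p), inv_neg, neg_smul, neg_add_eq_sub, ← smul_sub, sub_sub_sub_cancel_left,
      ← map_sub (algebraMap ℂ (Poly V)), Algebra.smul_def, ← map_mul, inv_mul_cancel₀ hα, map_one]

lemma map_mem_pow {f : Poly V →ₐ[ℂ] Poly V} {I J : Ideal (Poly V)} (h : ∀ F ∈ I, f F ∈ J) {k : ℕ}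
    {F : Poly V} (hF : F ∈ I ^ k) : f F ∈ J ^ k :=
  Ideal.le_comap_pow f k (Ideal.pow_right_mono (show I ≤ J.comap f from h) k hF)

variable (b : V)

/-- The expansion of a polynomial function at `w⁻¹ b`, moved to the origin by `w`:
`F(v) ↦ F(w⁻¹ (v + b))`. -/
def polyGerm (w : W) : Poly V →ₐ[ℂ] Poly V := (polyShift b).comp (polyAct (w : V ≃ₗ[ℂ] V))

lemma polyGerm_apply (w : W) (F : Poly V) :
    polyGerm b w F = polyShift b (polyAct (w : V ≃ₗ[ℂ] V) F) := rfl

lemma polyGerm_surjective (w : W) : Function.Surjective (polyGerm b w) := by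
  intro F
  refine ⟨polyAct (w : V ≃ₗ[ℂ] V)⁻¹ (polyShift (-b) F), ?_⟩
  rw [polyGerm_apply, ← AlgHom.comp_apply (polyAct _), ← polyAct_mul, mul_inv_cancel, polyAct_one,
    AlgHom.id_apply, polyShift_polyShift_neg]

lemma polyGerm_mul_left (h : pointStabilizer W b) (w : W) (F : Poly V) :
    polyGerm b (Subgroup.inclusion (pointStabilizer_le W b) h * w) F =
      polyAct (h : V ≃ₗ[ℂ] V) (polyGerm b w F) := by
  have hb : (h : V ≃ₗ[ℂ] V) b = b := h.2.2
  rw [polyGerm_apply, polyGerm_apply, ← polyShift_polyAct, hb, ← AlgHom.comp_apply (polyAct _),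
    ← polyAct_mul]
  rfl

/-- The map is an automorphism carrying the ideal of `w⁻¹ b` to that of the origin, so powers
correspond in both directions. -/
lemma polyGerm_mem_pow_iff (w : W) (k : ℕ) (F : Poly V) :
    polyGerm b w F ∈ pointIdeal (0 : V) ^ k ↔
      F ∈ pointIdeal ((w : V ≃ₗ[ℂ] V)⁻¹ b) ^ k := by
  constructor
  · intro h
    have := map_mem_pow (f := (polyAct (w : V ≃ₗ[ℂ] V)⁻¹).comp (polyShift (-b)))
      (J := pointIdeal ((w : V ≃ₗ[ℂ] V)⁻¹ b)) (fun G hG => ?_) h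
    · have e : polyShift (-b) (polyShift b (polyAct (w : V ≃ₗ[ℂ] V) F)) =
          polyAct (w : V ≃ₗ[ℂ] V) F := by
        simpa using polyShift_polyShift_neg (-b) (polyAct (w : V ≃ₗ[ℂ] V) F)
      rwa [AlgHom.comp_apply, polyGerm_apply, e, ← AlgHom.comp_apply, ← polyAct_mul,
        inv_mul_cancel, polyAct_one, AlgHom.id_apply] at this
    · rw [RingHom.mem_ker] at hG ⊢
      have e : (w : V ≃ₗ[ℂ] V)⁻¹⁻¹ ((w : V ≃ₗ[ℂ] V)⁻¹ b) = b :=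
        LinearEquiv.symm_apply_apply (w : V ≃ₗ[ℂ] V)⁻¹ b
      rw [AlgHom.comp_apply, evalAt_polyAct, evalAt_polyShift, e, add_neg_cancel, hG]
  · refine map_mem_pow fun G hG => ?_
    rw [RingHom.mem_ker] at hG ⊢
    rw [polyGerm_apply, evalAt_polyShift, zero_add, evalAt_polyAct, hG]

variable (W) in
/-- The points `w⁻¹ b` of the orbit. -/
abbrev orbitPoints : Set V := Set.range fun w : W => (w : V ≃ₗ[ℂ] V)⁻¹ b

/-- Indexing by points instead of group elements removes repetitions, as needed for pairwise
coprimality. -/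
lemma orbitIdeal_eq_iInf : orbitIdeal W b = ⨅ p : orbitPoints W b, pointIdeal (p : V) := by
  rw [iInf_range' (fun p => pointIdeal p), orbitIdeal, ← (Equiv.inv W).iInf_comp]
  rfl

lemma pairwise_isCoprime_pointIdeal_pow (O : Set V) (k : ℕ) :
    Pairwise (Function.onFun IsCoprime fun p : O => pointIdeal (p : V) ^ k) := fun _ _ h =>
  (isCoprime_pointIdeal fun e => h (Subtype.ext e)).pow

/-- For finitely many pairwise coprime ideals intersections are products, and this persists for
powers. Thus vanishing to order `k` along the orbit can be tested at each point. -/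
lemma mem_orbitIdeal_pow_iff [Finite W] (k : ℕ) (F : Poly V) :
    F ∈ orbitIdeal W b ^ k ↔ ∀ w : W, polyGerm b w F ∈ pointIdeal (0 : V) ^ k := by
  have := Fintype.ofFinite (orbitPoints W b)
  have h (k : ℕ) : ∏ p : orbitPoints W b, pointIdeal (p : V) ^ k =
      ⨅ p : orbitPoints W b, pointIdeal (p : V) ^ k := by
    rw [Ideal.prod_eq_iInf_of_pairwise_isCoprime
      fun p _ q _ => @pairwise_isCoprime_pointIdeal_pow V _ _ (orbitPoints W b) k p q]
    simp
  have h1 : orbitIdeal W b = ∏ p : orbitPoints W b, pointIdeal (p : V) := by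
    simpa [orbitIdeal_eq_iInf] using (h 1).symm
  rw [h1, ← Finset.prod_pow, h, Submodule.mem_iInf]
  simp only [polyGerm_mem_pow_iff, Subtype.forall, Set.forall_mem_range]

/-! ### Germs of functions on the formal neighbourhood of an orbit -/

lemma val_eq_iff_evalₐ_eq {I : Ideal (Poly V)} {φ ψ : AdicCompletion I (Poly V)} {k : ℕ} :
    φ.val k = ψ.val k ↔ AdicCompletion.evalₐ I k φ = AdicCompletion.evalₐ I k ψ := by
  have h : (I ^ k • ⊤ : Ideal (Poly V)) = I ^ k := by ext x; simp
  exact (Ideal.quotientEquivAlgOfEq (Poly V) h).injective.eq_iff.symm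

lemma polyGerm_mem_of_mem [Finite W] (w : W) {k : ℕ} {F : Poly V}
    (hF : F ∈ orbitIdeal W b ^ k) :
    polyGerm b w F ∈ orbitIdeal (pointStabilizer W b) (0 : V) ^ k := by
  rw [orbitIdeal_zero]
  exact (mem_orbitIdeal_pow_iff b k F).1 hF w

/-- The reduction modulo `k`-th powers of ideals of the germ at `w⁻¹ b`. -/
def germMod [Finite W] (w : W) (k : ℕ) :
    FormalFun W b →ₐ[ℂ] Poly V ⧸ orbitIdeal (pointStabilizer W b) (0 : V) ^ k :=
  (Ideal.quotientMapₐ (orbitIdeal (pointStabilizer W b) (0 : V) ^ k) (polyGerm b w)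
    fun _ hF => polyGerm_mem_of_mem b w hF).comp
      ((AdicCompletion.evalₐ (orbitIdeal W b) k).restrictScalars ℂ)

lemma germMod_eq [Finite W] (w : W) {φ : FormalFun W b} {k : ℕ} {F : Poly V}
    (h : φ.val k = (AdicCompletion.of _ _ F).val k) :
    germMod b w k φ = Ideal.Quotient.mk _ (polyGerm b w F) := by
  rw [val_eq_iff_evalₐ_eq] at h
  rw [germMod, AlgHom.comp_apply, AlgHom.restrictScalars_apply, h, AdicCompletion.evalₐ_of]
  rfl

lemma factor_comp_germMod [Finite W] (w : W) {m n : ℕ} (hmn : m ≤ n) :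
    (Ideal.Quotient.factorₐ ℂ (Ideal.pow_le_pow_right hmn)).comp (germMod b w n) =
      germMod b w m := by
  ext φ
  obtain ⟨F, hF⟩ := exists_of_val_eq φ n
  rw [AlgHom.comp_apply, germMod_eq b w hF, germMod_eq b w (val_eq_of_le hmn hF)]
  rfl

/-- The germ at `w⁻¹ b` of a function on the formal neighbourhood of the orbit of `b`, moved to the
origin by `w`. -/
def germ [Finite W] (w : W) : FormalFun W b →ₐ[ℂ] FormalFun (pointStabilizer W b) 0 :=
  AdicCompletion.liftAlgHom _ (germMod b w) (factor_comp_germMod b w)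

variable {b}

lemma germ_val_eq [Finite W] (w : W) {φ : FormalFun W b} {k : ℕ} {F : Poly V}
    (h : φ.val k = (AdicCompletion.of _ _ F).val k) :
    (germ b w φ).val k = (AdicCompletion.of _ _ (polyGerm b w F)).val k := by
  rw [val_eq_iff_evalₐ_eq, AdicCompletion.evalₐ_of, ← germMod_eq b w h]
  exact AdicCompletion.evalₐ_liftAlgHom _ _ (factor_comp_germMod b w) k φ

lemma germ_of [Finite W] (w : W) (F : Poly V) :
    germ b w (AdicCompletion.of _ _ F) = AdicCompletion.of _ _ (polyGerm b w F) :=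
  AdicCompletion.ext fun _ => germ_val_eq w rfl

lemma IsAdicContinuous.germ [Finite W] (w : W) : IsAdicContinuous (germ b w) :=
  ⟨0, fun k φ ψ h => by
    obtain ⟨F, hF⟩ := exists_of_val_eq ψ k
    exact (germ_val_eq w (h.trans hF)).trans (germ_val_eq w hF).symm⟩

lemma IsAdicContinuous.formalAct (u : W) : IsAdicContinuous (formalAct W b u) := .extend _

lemma formalAct_of (u : W) (F : Poly V) :
    formalAct W b u (AdicCompletion.of _ _ F) =
      AdicCompletion.of _ _ (polyAct (u : V ≃ₗ[ℂ] V) F) := rfl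

lemma germ_inclusion_mul [Finite W] (h : pointStabilizer W b) (w : W) (φ : FormalFun W b) :
    germ b (Subgroup.inclusion (pointStabilizer_le W b) h * w) φ =
      formalAct (pointStabilizer W b) 0 h (germ b w φ) := by
  refine (IsAdicContinuous.germ _).ext ((IsAdicContinuous.formalAct h).comp (.germ w))
    (fun F => ?_) φ
  rw [germ_of, germ_of, formalAct_of, polyGerm_mul_left]

lemma germ_formalAct [Finite W] (u w : W) (φ : FormalFun W b) :
    germ b w (formalAct W b u φ) = germ b (w * u) φ := by
  refine ((IsAdicContinuous.germ w).comp (.formalAct u)).ext (.germ _) (fun F => ?_) φ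
  rw [germ_of, formalAct_of, germ_of, polyGerm_apply, polyGerm_apply, Subgroup.coe_mul,
    polyAct_mul, AlgHom.comp_apply]

lemma germ_ext [Finite W] {φ ψ : FormalFun W b} (h : ∀ w, germ b w φ = germ b w ψ) : φ = ψ := by
  rw [← sub_eq_zero]
  refine AdicCompletion.ext fun k => ?_
  obtain ⟨F, hF⟩ := exists_of_val_eq (φ - ψ) k
  rw [hF, AdicCompletion.val_zero_apply, of_val_eq_zero_iff, mem_orbitIdeal_pow_iff]
  intro w
  have := germ_val_eq w hF
  rw [map_sub, h, sub_self, AdicCompletion.val_zero_apply, eq_comm, of_val_eq_zero_iff,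
    orbitIdeal_zero] at this
  exact this

lemma formalAct_val_eq (u : W) {φ : FormalFun W b} {k : ℕ} {F : Poly V}
    (h : φ.val (k + 1) = (AdicCompletion.of _ _ F).val (k + 1)) :
    (formalAct W b u φ).val k = (AdicCompletion.of _ _ (polyAct (u : V ≃ₗ[ℂ] V) F)).val k :=
  congrArg (extendAux ⟨_, polyAct_mem_shiftOps W b u⟩ k) h

variable (W b) in
/-- The `W_b`-equivariant functions on `W` with values in `ℂ[[V]]`. -/
def germFamilies : Submodule ℂ (W → FormalFun (pointStabilizer W b) 0) where
  carrier := {q | ∀ h w, q (Subgroup.inclusion (pointStabilizer_le W b) h * w) =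
    formalAct (pointStabilizer W b) 0 h (q w)}
  add_mem' hq hq' h w := by simp [hq h w, hq' h w]
  zero_mem' h w := by simp
  smul_mem' t q hq h w := by simp [hq h w]

/-- This is the surjective half of the Chinese remainder theorem at finite level. One group element
is chosen over each orbit point and the congruences are solved there; equivariance under `W_b` gives
the remaining group elements. -/
lemma exists_polyGerm_val_eq [Finite W] {q : W → FormalFun (pointStabilizer W b) 0}
    (hq : q ∈ germFamilies W b) (k : ℕ) :
    ∃ F : Poly V, ∀ w, (AdicCompletion.of _ _ (polyGerm b w F)).val k = (q w).val k := by
  choose u hu using fun p : orbitPoints W b => p.2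
  -- The order `k + 1` compensates for the order lost in `formalAct_val_eq`, where the action is
  -- treated as an operator that may lower the vanishing order by one.
  choose G hG using fun p : orbitPoints W b => exists_of_val_eq (q (u p)) (k + 1)
  choose H hH using fun p : orbitPoints W b => polyGerm_surjective b (u p) (G p)
  obtain ⟨F, hF⟩ := Ideal.exists_forall_sub_mem_ideal
    (pairwise_isCoprime_pointIdeal_pow (orbitPoints W b) (k + 1)) H
  refine ⟨F, fun w => ?_⟩
  set p : orbitPoints W b := ⟨_, w, rfl⟩ with hp
  have h1 : (q (u p)).val (k + 1) =
      (AdicCompletion.of _ _ (polyGerm b (u p) F)).val (k + 1) := by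
    have h2 := hF p
    have h3 : (p : V) = (u p : V ≃ₗ[ℂ] V)⁻¹ b := (hu p).symm
    rw [h3, ← polyGerm_mem_pow_iff b (u p), map_sub, hH,
      ← orbitIdeal_zero (W := pointStabilizer W b), ← of_val_eq_zero_iff, map_sub,
      AdicCompletion.val_sub_apply, sub_eq_zero] at h2
    rw [hG, h2]
  have hmem : (w : V ≃ₗ[ℂ] V) * (u p : V ≃ₗ[ℂ] V)⁻¹ ∈ pointStabilizer W b := by
    refine ⟨W.mul_mem w.2 (W.inv_mem (u p).2), ?_⟩
    have h3 : (u p : V ≃ₗ[ℂ] V)⁻¹ b = (w : V ≃ₗ[ℂ] V)⁻¹ b := hu p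
    change (w : V ≃ₗ[ℂ] V) ((u p : V ≃ₗ[ℂ] V)⁻¹ b) = b
    rw [h3]
    exact LinearEquiv.apply_symm_apply _ _
  have hw : Subgroup.inclusion (pointStabilizer_le W b) ⟨_, hmem⟩ * u p = w := by
    ext1
    simp
  rw [← hw, hq, polyGerm_mul_left, formalAct_val_eq _ h1]

lemma exists_germ_eq [Finite W] {q : W → FormalFun (pointStabilizer W b) 0}
    (hq : q ∈ germFamilies W b) : ∃ φ : FormalFun W b, ∀ w, germ b w φ = q w := by
  choose F hF using exists_polyGerm_val_eq hq
  let φ : FormalFun W b := ⟨fun k => (AdicCompletion.of _ _ (F k)).val k, fun {m n} hmn => by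
    -- Successive approximations are compatible because their germs agree at every point of the
    -- orbit.
    have h1 : (AdicCompletion.of (orbitIdeal W b) (Poly V) (F n - F m)).val m = 0 := by
      rw [of_val_eq_zero_iff, mem_orbitIdeal_pow_iff]
      intro w
      rw [← orbitIdeal_zero (W := pointStabilizer W b), ← of_val_eq_zero_iff, map_sub, map_sub,
        AdicCompletion.val_sub_apply, hF m w, sub_eq_zero]
      exact val_eq_of_le hmn (hF n w)
    rw [map_sub, AdicCompletion.val_sub_apply, sub_eq_zero] at h1
    exact ((AdicCompletion.of (orbitIdeal W b) (Poly V) (F n)).2 hmn).trans h1⟩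
  refine ⟨φ, fun w => AdicCompletion.ext fun k => ?_⟩
  rw [germ_val_eq w (φ := φ) (k := k) (F := F k) rfl, hF]

end

end Cherednik

/-! ### Dunkl operators in terms of germs -/

namespace Cherednik

noncomputable section

open Module

variable {V : Type*} [AddCommGroup V] [Module ℂ V] {W : Subgroup (V ≃ₗ[ℂ] V)}

instance isNoetherianRing_poly [FiniteDimensional ℂ V] : IsNoetherianRing (Poly V) :=
  isNoetherianRing_of_ringEquiv _
    (SymmetricAlgebra.equivMvPolynomial (finBasis ℂ (Dual ℂ V))).symm.toRingEquiv

/-- A linear form vanishes at the origin, so it lies in the Jacobson radical of the complete ring,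
and adding a nonzero constant gives a unit. Hence `Ring.inverse` in `invShifted` is a true inverse
whenever `α(b) ≠ 0`. -/
lemma isUnit_formalLin_add [FiniteDimensional ℂ V] (α : Dual ℂ V) {t : ℂ} (ht : t ≠ 0) :
    IsUnit (formalLin W 0 α + algebraMap ℂ _ t) := by
  have := AdicCompletion.isAdicComplete_self (orbitIdeal W (0 : V)) (Ideal.fg_of_isNoetherianRing _)
  have hmem : formalLin W 0 α ∈ (⊥ : Ideal (FormalFun W (0 : V))).jacobson := by
    refine IsAdicComplete.le_jacobson_bot ((orbitIdeal W (0 : V)).map (algebraMap _ _))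
      (Ideal.mem_map_of_mem (algebraMap (Poly V) (FormalFun W (0 : V))) (?_ : lin α ∈ _))
    rw [orbitIdeal_zero, RingHom.mem_ker, evalAt_lin, map_zero]
  have h1 := Ideal.mem_jacobson_bot.1 hmem (algebraMap ℂ _ t⁻¹)
  have h2 : formalLin W 0 α + algebraMap ℂ _ t =
      (formalLin W 0 α * algebraMap ℂ _ t⁻¹ + 1) * algebraMap ℂ _ t := by
    rw [add_mul, mul_assoc, ← map_mul, inv_mul_cancel₀ ht, map_one, mul_one, one_mul]
  rw [h2]
  exact h1.mul ((IsUnit.mk0 t ht).map _)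

section

variable (r : Roots W) (c : reflections W → ℂ) {b : V}

/-- As `s` fixes `b`, the root vanishes at `b`, so translation by `b` fixes the root and commutes
with `s`. -/
lemma polyShift_divDiff_of_mem {s : reflections W} (hs : (s : V ≃ₗ[ℂ] V) ∈ pointStabilizer W b)
    (F : Poly V) : polyShift b (divDiff r s F) = divDiff r s (polyShift b F) := by
  have hb : (s : V ≃ₗ[ℂ] V) b = b := hs.2
  apply mul_left_cancel₀ (lin_root_ne_zero r s)
  have h1 : polyShift b (lin (r.root s)) = lin (r.root s) := by
    rw [polyShift_lin, (refl_apply_eq_self_iff r s b).1 hb, map_zero, add_zero]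
  have h2 := polyShift_polyAct (s : V ≃ₗ[ℂ] V) b F
  rw [hb] at h2
  rw [root_mul_divDiff, ← h2, ← map_sub, ← root_mul_divDiff r, map_mul, h1]

lemma root_apply_ne_zero {s : reflections W} (hs : (s : V ≃ₗ[ℂ] V) ∉ pointStabilizer W b) :
    r.root s b ≠ 0 := fun h => hs ⟨s.2.1, (refl_apply_eq_self_iff r s b).2 h⟩

lemma of_polyShift_divDiff_of_notMem [FiniteDimensional ℂ V] {s : reflections W}
    (hs : (s : V ≃ₗ[ℂ] V) ∉ pointStabilizer W b) (F : Poly V) :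
    AdicCompletion.of (orbitIdeal (pointStabilizer W b) 0) _ (polyShift b (divDiff r s F)) =
      invShifted W b (r.root s) * (AdicCompletion.of _ _
        (polyShift b (polyAct (s : V ≃ₗ[ℂ] V) F)) - AdicCompletion.of _ _ (polyShift b F)) := by
  have hu := isUnit_formalLin_add (W := pointStabilizer W b) (r.root s)
    (root_apply_ne_zero r hs)
  apply hu.mul_left_cancel
  rw [invShifted, ← mul_assoc, Ring.mul_inverse_cancel _ hu, one_mul, formalLin, ← of_algebraMap,
    ← map_add, ← polyShift_lin, ← of_mul, ← map_mul, root_mul_divDiff, map_sub, map_sub]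

variable (b) in
/-- The Dunkl-Opdam operators of `W_b` from those of `W`. -/
lemma dunkl_restrict_apply [Fintype (reflections W)] [Finite W]
    [DecidablePred fun s : reflections W => (s : V ≃ₗ[ℂ] V) ∈ pointStabilizer W b]
    (a : V) (F : Poly V) :
    dunkl (r.restrict (pointStabilizer_le W b)) (restrictParam (pointStabilizer_le W b) c) a F =
      deriv a F + ∑ s : reflections W, if (s : V ≃ₗ[ℂ] V) ∈ pointStabilizer W b then
        (2 * c s / (1 - r.eig s) * r.root s a) • divDiff r s F else 0 := by
  have := Fintype.ofFinite (reflections (pointStabilizer W b))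
  rw [dunkl_apply]
  congr 1
  refine Fintype.sum_of_injective (Set.inclusion (reflections_mono (pointStabilizer_le W b)))
    (Set.inclusion_injective _) _ _ (fun s hs => if_neg fun h => hs ⟨⟨s, h, s.2.2⟩, rfl⟩)
    fun s => ?_
  rw [if_pos s.2.1]
  rfl

/-- Reflections in `W_b` contribute the Dunkl operator of `W_b`; the others contribute terms with
invertible denominators. -/
lemma polyShift_dunkl [FiniteDimensional ℂ V] [Finite W] [Fintype (reflections W)]
    [DecidablePred fun s : reflections W => (s : V ≃ₗ[ℂ] V) ∈ pointStabilizer W b]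
    (a : V) (F : Poly V) :
    AdicCompletion.of (orbitIdeal (pointStabilizer W b) 0) _ (polyShift b (dunkl r c a F)) =
      AdicCompletion.of _ _ (dunkl (r.restrict (pointStabilizer_le W b))
        (restrictParam (pointStabilizer_le W b) c) a (polyShift b F)) +
      ∑ s : reflections W, if (s : V ≃ₗ[ℂ] V) ∈ pointStabilizer W b then 0 else
        (2 * c s / (1 - r.eig s)) • (r.root s a • invShifted W b (r.root s) *
          (AdicCompletion.of _ _ (polyShift b (polyAct (s : V ≃ₗ[ℂ] V) F)) -
            AdicCompletion.of _ _ (polyShift b F))) := by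
  rw [dunkl_apply, dunkl_restrict_apply, map_add, map_add, polyShift_deriv, map_add, add_assoc,
    map_sum, map_sum, map_sum, ← Finset.sum_add_distrib]
  congr 2
  ext1 s
  split_ifs with hs
  · rw [add_zero, map_smul, polyShift_divDiff_of_mem r hs]
  · rw [map_zero, zero_add, map_smul, of_smul, of_polyShift_divDiff_of_notMem r hs, mul_smul,
      smul_mul_assoc]

/-- Both sides are continuous in `φ`, so polynomials suffice. There, moving `w` past `D_a` turns it
into `D_{wa}`, and `polyShift_dunkl` applies. -/
lemma germ_dunklOp [FiniteDimensional ℂ V] [Finite W] (hc : IsInvariant c)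
    [Fintype (reflections W)]
    [DecidablePred fun s : reflections W => (s : V ≃ₗ[ℂ] V) ∈ pointStabilizer W b]
    (a : V) (w : W) (φ : FormalFun W b) :
    germ b w ((completion.dunklOp r c b a).1 φ) =
      (completion.dunklOp (r.restrict (pointStabilizer_le W b))
        (restrictParam (pointStabilizer_le W b) c) 0 ((w : V ≃ₗ[ℂ] V) a)).1 (germ b w φ) +
      ∑ s : reflections W, if (s : V ≃ₗ[ℂ] V) ∈ pointStabilizer W b then 0 else
        (2 * c s / (1 - r.eig s)) • (r.root s ((w : V ≃ₗ[ℂ] V) a) • invShifted W b (r.root s) *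
          (germ b (⟨s, s.2.1⟩ * w) φ - germ b w φ)) := by
  have h1 (s : reflections W) : IsAdicContinuous fun φ : FormalFun W b =>
      if (s : V ≃ₗ[ℂ] V) ∈ pointStabilizer W b then 0 else
        (2 * c s / (1 - r.eig s)) • (r.root s ((w : V ≃ₗ[ℂ] V) a) • invShifted W b (r.root s) *
          (germ b (⟨s, s.2.1⟩ * w) φ - germ b w φ)) := by
    split_ifs with hs
    · exact .const 0
    · have h := (IsAdicContinuous.germ (b := b) (⟨s, s.2.1⟩ * w)).sub (IsAdicContinuous.germ w)
      have h' := (IsAdicContinuous.const (I := orbitIdeal W b)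
        (r.root s ((w : V ≃ₗ[ℂ] V) a) • invShifted W b (r.root s))).mul h
      exact h'.smul (2 * c s / (1 - r.eig s))
  have h2 := IsAdicContinuous.sum Finset.univ h1
  have h3 : IsAdicContinuous fun φ : FormalFun W b =>
      (completion.dunklOp (r.restrict (pointStabilizer_le W b))
        (restrictParam (pointStabilizer_le W b) c) 0 ((w : V ≃ₗ[ℂ] V) a)).1 (germ b w φ) :=
    (isAdicContinuous_coe _).comp (.germ w)
  have h4 : IsAdicContinuous fun φ => germ b w ((completion.dunklOp r c b a).1 φ) :=
    (IsAdicContinuous.germ w).comp (isAdicContinuous_coe _)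
  refine h4.ext (h3.add h2) (fun F => ?_) φ
  simp only [dunklOp_of, germ_of, polyGerm_apply, polyAct_dunkl r hc, polyShift_dunkl,
      Subgroup.coe_mul, polyAct_mul, AlgHom.comp_apply]

end

end

end Cherednik

namespace Cherednik

noncomputable section

open Module

variable {V : Type*} [AddCommGroup V] [Module ℂ V] {W : Subgroup (V ≃ₗ[ℂ] V)}
  {r : Roots W} {c : reflections W → ℂ} {b : V}

/-! ### Rigidity of the completed algebra -/

variable (r c b) in
/-- Functions on the formal neighbourhood form a commutative subalgebra of the completed algebra. -/
def funcHom : FormalFun W b →ₐ[ℂ] completion r c b :=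
  (Algebra.lmul ℂ (FormalFun W b)).codRestrict (completion r c b)
    fun φ => (completion.func r c b φ).2

lemma funcHom_apply (φ : FormalFun W b) : funcHom r c b φ = completion.func r c b φ := rfl

lemma funcHom_apply_apply (φ ψ : FormalFun W b) : (funcHom r c b φ).1 ψ = φ * ψ := rfl

variable (W b) in
/-- Polynomial functions as functions on the formal neighbourhood. -/
def ofHom : Poly V →ₐ[ℂ] FormalFun W b :=
  { toFun := AdicCompletion.of _ _
    map_one' := of_one
    map_mul' := of_mul
    map_zero' := map_zero _
    map_add' := map_add _
    commutes' := of_algebraMap }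

lemma ofHom_apply (F : Poly V) : ofHom W b F = AdicCompletion.of _ _ F := rfl

/-- Such an operator commutes with all polynomials, so it sends `F = F · 1` to `F` times its value
at `1`; continuity does the rest. -/
lemma exists_eq_func_of_commute (T : completion r c b)
    (hT : ∀ α, Commute T (completion.func r c b (formalLin W b α))) :
    T = completion.func r c b (T.1 1) := by
  have h (F : Poly V) : Commute T (funcHom r c b (ofHom W b F)) := by
    induction F using SymmetricAlgebra.induction with
    | algebraMap t => simp only [AlgHom.commutes]; exact (Algebra.commute_algebraMap_left t T).symm
    | ι α => exact hT α
    | mul F G hF hG => simp only [map_mul]; exact hF.mul_right hG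
    | add F G hF hG => simp only [map_add]; exact hF.add_right hG
  refine completion_ext fun F => ?_
  have h1 := LinearMap.congr_fun (congrArg Subtype.val (h F).eq) 1
  rw [MulMemClass.coe_mul, MulMemClass.coe_mul, Module.End.mul_apply, Module.End.mul_apply,
    funcHom_apply_apply, funcHom_apply_apply, mul_one] at h1
  exact h1.trans (mul_comm _ _)

lemma eq_id_of_fixes_generators [FiniteDimensional ℂ V]
    (Φ : completion r c b →ₐ[ℂ] completion r c b)
    (hg : ∀ w, Φ (completion.grp r c b w) = completion.grp r c b w)
    (hx : ∀ α, Φ (completion.func r c b (formalLin W b α)) =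
      completion.func r c b (formalLin W b α))
    (hy : ∀ a, Φ (completion.dunklOp r c b a) = completion.dunklOp r c b a)
    (T : completion r c b) : Φ T = T := by
  have hof (F : Poly V) : Φ (funcHom r c b (ofHom W b F)) = funcHom r c b (ofHom W b F) := by
    induction F using SymmetricAlgebra.induction with
    | algebraMap t => simp only [AlgHom.commutes]
    | ι α => exact hx α
    | mul F G hF hG => simp only [map_mul, hF, hG]
    | add F G hF hG => simp only [map_add, hF, hG]
  have hfunc (φ : FormalFun W b) : Φ (completion.func r c b φ) = completion.func r c b φ := by
    -- The image of a function commutes with the linear forms, which `Φ` fixes, so it is again a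
    -- function, namely its own value at `1`.
    let η (φ : FormalFun W b) : FormalFun W b := (Φ (completion.func r c b φ)).1 1
    have hη (φ : FormalFun W b) : Φ (completion.func r c b φ) = completion.func r c b (η φ) := by
      refine exists_eq_func_of_commute _ fun α => ?_
      rw [← hx α]
      refine Commute.map ?_ Φ
      exact (Commute.all φ (formalLin W b α)).map (funcHom r c b)
    have hadd (φ ψ : FormalFun W b) : η (φ + ψ) = η φ + η ψ := by
      simp only [η, ← funcHom_apply, map_add]
      rfl
    have hsmul (F : Poly V) (φ : FormalFun W b) : η (F • φ) = F • η φ := by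
      have e (ψ : FormalFun W b) : F • ψ = ofHom W b F * ψ := by
        rw [Algebra.smul_def]; rfl
      simp only [η, ← funcHom_apply, e, map_mul, hof]
      rfl
    have hηof (F : Poly V) : η (AdicCompletion.of _ _ F) = AdicCompletion.of _ _ F := by
      have := hof F
      rw [funcHom_apply, ofHom_apply] at this
      simp only [η, this]
      exact mul_one _
    -- Since the ideal is finitely generated, the kernel of reduction modulo its `k`-th power is
    -- generated by that power. Linearity of `η` over polynomials then preserves this kernel, which
    -- is the continuity needed.
    have hmem (k : ℕ) (χ : FormalFun W b) (hχ : χ.val k = 0) : (η χ).val k = 0 := by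
      have key := AdicCompletion.pow_smul_top_eq_ker_eval (M := Poly V) (n := k)
        (Ideal.fg_of_isNoetherianRing (orbitIdeal W b))
      have h1 : χ ∈ (orbitIdeal W b ^ k • ⊤ : Submodule (Poly V) (FormalFun W b)) := by
        rw [key]; exact hχ
      have h2 : η χ ∈ (orbitIdeal W b ^ k • ⊤ : Submodule (Poly V) (FormalFun W b)) := by
        refine Submodule.smul_induction_on (p := fun χ => η χ ∈ _) h1 (fun F hF ψ _ => ?_)
          fun ψ ψ' h h' => ?_
        · rw [hsmul]; exact Submodule.smul_mem_smul hF trivial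
        · rw [hadd]; exact add_mem h h'
      rw [key] at h2
      exact h2
    rw [hη]
    congr 1
    refine AdicCompletion.ext fun k => ?_
    obtain ⟨F, hF⟩ := exists_of_val_eq φ k
    have h1 := hmem k (φ - AdicCompletion.of _ _ F)
      (by rw [AdicCompletion.val_sub_apply, hF, sub_self])
    have h2 := hadd (φ - AdicCompletion.of _ _ F) (AdicCompletion.of _ _ F)
    rw [sub_add_cancel, hηof] at h2
    rw [h2, AdicCompletion.val_add_apply, h1, zero_add, hF]
  obtain ⟨T, hT⟩ := T
  induction hT using Algebra.adjoin_induction with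
  | mem T hT =>
    obtain ((⟨φ, rfl⟩ | ⟨u, rfl⟩) | ⟨a, rfl⟩) := hT
    · exact hfunc φ
    · exact hg u
    · exact hy a
  | algebraMap t => exact Φ.commutes t
  | add T T' hT hT' h h' =>
    exact (map_add Φ ⟨T, hT⟩ ⟨T', hT'⟩).trans (congrArg₂ (· + ·) h h')
  | mul T T' hT hT' h h' =>
    exact (map_mul Φ ⟨T, hT⟩ ⟨T', hT'⟩).trans (congrArg₂ (· * ·) h h')

lemma algEquiv_ext_of_generators [FiniteDimensional ℂ V] {Z : Type*} [Semiring Z] [Algebra ℂ Z]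
    (θ θ' : completion r c b ≃ₐ[ℂ] Z)
    (hg : ∀ w, θ' (completion.grp r c b w) = θ (completion.grp r c b w))
    (hx : ∀ α, θ' (completion.func r c b (formalLin W b α)) =
      θ (completion.func r c b (formalLin W b α)))
    (hy : ∀ a, θ' (completion.dunklOp r c b a) = θ (completion.dunklOp r c b a)) : θ' = θ := by
  ext T
  have h := eq_id_of_fixes_generators (θ'.trans θ.symm).toAlgHom
    (fun w => (θ.symm_apply_eq).2 (hg w)) (fun α => (θ.symm_apply_eq).2 (hx α))
    (fun a => (θ.symm_apply_eq).2 (hy a)) T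
  exact (θ.symm_apply_eq).1 h

end

end Cherednik

namespace Cherednik

noncomputable section

open Module

/-! ### Algebras of operators and centralizer algebras -/

section GermSystem

variable {G H E M : Type*} [Group G] [Group H] [AddCommGroup E] [Module ℂ E] [AddCommGroup M]
  [Module ℂ M] {A : Subalgebra ℂ (Module.End ℂ E)}

/-- An identification of `M` with the space of `H`-equivariant functions `G → E`. -/
structure GermSystem (i : H →* G) (j : H →* A) (M : Type*) [AddCommGroup M] [Module ℂ M] where
  germ : G → M →ₗ[ℂ] E
  germ_mul : ∀ h g m, germ (i h * g) m = (j h).1 (germ g m)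
  ext : ∀ m m', (∀ g, germ g m = germ g m') → m = m'
  exists_germ : ∀ q : G → E, (∀ h g, q (i h * g) = (j h).1 (q g)) → ∃ m, ∀ g, germ g m = q g

namespace GermSystem

variable {i : H →* G} {j : H →* A} (D : GermSystem i j M)

lemma exists_glue (f : funH i j) (ψ : E) : ∃ m, ∀ g, D.germ g m = (f.1 g).1 ψ :=
  D.exists_germ _ fun h g => by rw [f.2 h g]; rfl

/-- The element of `M` with germs `f g ψ`. -/
def glue (f : funH i j) (ψ : E) : M := (D.exists_glue f ψ).choose

lemma germ_glue (f : funH i j) (ψ : E) (g : G) : D.germ g (D.glue f ψ) = (f.1 g).1 ψ :=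
  (D.exists_glue f ψ).choose_spec g

lemma glue_smul_op (f : funH i j) (a : A) (ψ : E) :
    D.glue (MulOpposite.op a • f) ψ = D.glue f (a.1 ψ) :=
  D.ext _ _ fun g => by rw [germ_glue, germ_glue]; rfl

lemma glue_add (f f' : funH i j) (ψ : E) : D.glue (f + f') ψ = D.glue f ψ + D.glue f' ψ :=
  D.ext _ _ fun g => by rw [map_add, germ_glue, germ_glue, germ_glue]; rfl

lemma glue_smul (t : ℂ) (f : funH i j) (ψ : E) : D.glue (t • f) ψ = t • D.glue f ψ :=
  D.ext _ _ fun g => by rw [map_smul, germ_glue, germ_glue]; rfl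

lemma glue_ext {f f' : funH i j} (h : ∀ ψ, D.glue f ψ = D.glue f' ψ) : f = f' := by
  refine Subtype.ext (funext fun g => Subtype.ext (LinearMap.ext fun ψ => ?_))
  rw [← D.germ_glue, h, germ_glue]

/-- `S` acts on equivariant families of operators as `T` acts on `M`. -/
def Intertwines (T : Module.End ℂ M) (S : centralizerAlg i j) : Prop :=
  ∀ f ψ, D.glue (S f) ψ = T (D.glue f ψ)

variable {D} {T T' : Module.End ℂ M} {S S' : centralizerAlg i j}

/-- The only real condition is that the germs of `T (glue f ψ)` are given by elements of `A` applied
to `ψ`. Equivariance, additivity and `A`-linearity follow, because a family is determined by its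
gluings. -/
lemma exists_intertwines_of_apply (F : funH i j → G → A)
    (hF : ∀ f g ψ, (F f g).1 ψ = D.germ g (T (D.glue f ψ))) : ∃ S, D.Intertwines T S := by
  have hmem (f : funH i j) : F f ∈ funH i j := fun h g => by
    refine Subtype.ext (LinearMap.ext fun ψ => ?_)
    rw [hF, D.germ_mul, ← hF]
    rfl
  have hglue (f : funH i j) (ψ : E) : D.glue ⟨F f, hmem f⟩ ψ = T (D.glue f ψ) :=
    D.ext _ _ fun g => by rw [germ_glue, hF]
  refine ⟨LinearMap.mk ⟨fun f => ⟨F f, hmem f⟩, fun f f' => ?_⟩ fun a f => ?_, hglue⟩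
  · refine D.glue_ext fun ψ => ?_
    rw [glue_add, hglue, hglue, hglue, glue_add, map_add]
  · refine D.glue_ext fun ψ => ?_
    obtain ⟨a, rfl⟩ := MulOpposite.op_surjective a
    simp only [RingHom.id_apply]
    rw [glue_smul_op, hglue, hglue, glue_smul_op]

namespace Intertwines

lemma apply (h : D.Intertwines T S) (f : funH i j) (g : G) (ψ : E) :
    ((S f).1 g).1 ψ = D.germ g (T (D.glue f ψ)) := by
  rw [← h f ψ, germ_glue]

lemma unique (h : D.Intertwines T S) (h' : D.Intertwines T S') : S = S' :=
  LinearMap.ext fun f => D.glue_ext fun ψ => (h f ψ).trans (h' f ψ).symm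

lemma one : D.Intertwines 1 1 := fun _ _ => rfl

lemma add (h : D.Intertwines T S) (h' : D.Intertwines T' S') :
    D.Intertwines (T + T') (S + S') :=
  fun f ψ => by rw [LinearMap.add_apply, LinearMap.add_apply, glue_add, h, h']

lemma mul (h : D.Intertwines T S) (h' : D.Intertwines T' S') :
    D.Intertwines (T * T') (S * S') :=
  fun f ψ => by rw [Module.End.mul_apply, Module.End.mul_apply, h, h']

lemma algebraMap (t : ℂ) : D.Intertwines (algebraMap ℂ _ t) (algebraMap ℂ _ t) :=
  fun f ψ => by rw [Module.algebraMap_end_apply, Module.algebraMap_end_apply, glue_smul]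

end Intertwines

/-- The homomorphism to the centralizer algebra determined by intertwining. -/
def centralizerHom {B : Subalgebra ℂ (Module.End ℂ M)} (hB : ∀ T ∈ B, ∃ S, D.Intertwines T S) :
    B →ₐ[ℂ] centralizerAlg i j :=
  have spec (T : B) : D.Intertwines T.1 (hB T.1 T.2).choose := (hB T.1 T.2).choose_spec
  { toFun T := (hB T.1 T.2).choose
    map_one' := (spec 1).unique .one
    map_mul' T T' := (spec (T * T')).unique ((spec T).mul (spec T'))
    map_zero' := (spec 0).unique (by simpa using Intertwines.algebraMap (D := D) 0)
    map_add' T T' := (spec (T + T')).unique ((spec T).add (spec T'))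
    commutes' t := (spec _).unique (.algebraMap t) }

lemma intertwines_centralizerHom {B : Subalgebra ℂ (Module.End ℂ M)}
    (hB : ∀ T ∈ B, ∃ S, D.Intertwines T S) (T : B) : D.Intertwines T.1 (centralizerHom hB T) :=
  (hB T.1 T.2).choose_spec

variable (D) in
/-- `T` acts on the germ at `1` by `a`, and takes values supported on `H`. -/
def IsCorner (T : Module.End ℂ M) (a : Module.End ℂ E) : Prop :=
  (∀ m, D.germ 1 (T m) = a (D.germ 1 m)) ∧ ∀ g ∉ Set.range i, ∀ m, D.germ g (T m) = 0

lemma IsCorner.add {a a' : Module.End ℂ E} (h : D.IsCorner T a) (h' : D.IsCorner T' a') :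
    D.IsCorner (T + T') (a + a') := by
  refine ⟨fun m => ?_, fun g hg m => ?_⟩
  · simp [h.1, h'.1]
  · simp [h.2 g hg, h'.2 g hg]

lemma IsCorner.mul {a a' : Module.End ℂ E} (h : D.IsCorner T a) (h' : D.IsCorner T' a') :
    D.IsCorner (T * T') (a * a') := by
  refine ⟨fun m => ?_, fun g hg m => ?_⟩
  · simp [h.1, h'.1]
  · simp [h.2 g hg]

open Classical in
variable (i j) in
/-- The function on `G` that extends `j` by zero. -/
def extendByZero (g : G) : A := if hg : ∃ h, i h = g then j hg.choose else 0

lemma extendByZero_apply (hi : Function.Injective i) (h : H) :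
    extendByZero i j (i h) = j h := by
  have hg : ∃ h', i h' = i h := ⟨h, rfl⟩
  rw [extendByZero, dif_pos hg, hi hg.choose_spec]

lemma extendByZero_of_notMem {g : G} (hg : g ∉ Set.range i) : extendByZero i j g = 0 :=
  dif_neg hg

lemma extendByZero_mul (hi : Function.Injective i) (h : H) (g : G) :
    extendByZero i j (i h * g) = j h * extendByZero i j g := by
  by_cases hg : g ∈ Set.range i
  · obtain ⟨k, rfl⟩ := hg
    rw [← map_mul, extendByZero_apply hi, extendByZero_apply hi, map_mul]
  · rw [extendByZero_of_notMem hg, extendByZero_of_notMem, mul_zero]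
    rintro ⟨k, hk⟩
    exact hg ⟨h⁻¹ * k, by rw [map_mul, map_inv, hk, inv_mul_cancel_left]⟩

variable (j) in
/-- The basis functions of `Fun_H(G, A)`. -/
def deltaFun (hi : Function.Injective i) (g : G) : funH i j :=
  ⟨fun w => extendByZero i j (w * g⁻¹), fun h _ =>
    (congrArg (extendByZero i j) (mul_assoc _ _ _)).trans (extendByZero_mul hi h _)⟩

open Classical in
-- Summing over all of `G` avoids choosing coset representatives. Each term in the coset of `w`
-- contributes `f w`, so the expansion in basis functions is multiplied by the order of the image of
-- `H`, which is invertible in `ℂ`.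
lemma sum_extendByZero_mul [Fintype G] (hi : Function.Injective i) (f : funH i j) (w : G) :
    ∑ g, extendByZero i j (w * g⁻¹) * f.1 g =
      (Finset.univ.filter (· ∈ Set.range i)).card • f.1 w := by
  have h (g : G) : extendByZero i j (w * g⁻¹) * f.1 g =
      if w * g⁻¹ ∈ Set.range i then f.1 w else 0 := by
    split_ifs with hg
    · obtain ⟨k, hk⟩ := hg
      rw [← hk, extendByZero_apply hi, ← f.2, hk, inv_mul_cancel_right]
    · rw [extendByZero_of_notMem hg, zero_mul]
  rw [Finset.sum_congr rfl fun g _ => h g, ← Finset.sum_const, Finset.sum_filter]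
  exact Fintype.sum_equiv (Equiv.divLeft w) _ _ fun g => by simp [div_eq_mul_inv]

lemma IsCorner.germ_eq (hi : Function.Injective i) {a : A} (h : D.IsCorner T a) (w : G) (m : M) :
    D.germ w (T m) = (extendByZero i j w * a).1 (D.germ 1 m) := by
  by_cases hw : w ∈ Set.range i
  · obtain ⟨k, rfl⟩ := hw
    rw [extendByZero_apply hi, ← mul_one (i k), D.germ_mul, h.1]
    rfl
  · rw [h.2 w hw, extendByZero_of_notMem hw, zero_mul]
    rfl

/-- An algebra `B` of operators that acts on families of operators with values in `A`, contains
the right translations and has `A` as corner is the centralizer algebra. -/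
theorem bijective_centralizerHom [Finite G] (hi : Function.Injective i)
    {B : Subalgebra ℂ (Module.End ℂ M)} (hB : ∀ T ∈ B, ∃ S, D.Intertwines T S) (ρ : G →* B)
    (hρ : ∀ u g m, D.germ g ((ρ u).1 m) = D.germ (g * u) m)
    (hA : ∀ a ∈ A, ∃ T ∈ B, D.IsCorner T a) : Function.Bijective (centralizerHom hB) := by
  classical
  have := Fintype.ofFinite G
  set n := (Finset.univ.filter (· ∈ Set.range i)).card with hn
  have hn0 : (n : ℂ) ≠ 0 := by
    rw [Nat.cast_ne_zero, ← Nat.pos_iff_ne_zero, hn, Finset.card_pos]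
    exact ⟨1, by simpa using ⟨1, map_one i⟩⟩
  constructor
  · intro T T' h
    refine Subtype.ext (LinearMap.ext fun m => ?_)
    -- Glued families span `M`: up to the factor `n`, an element is the sum of the basis functions
    -- glued with its own germs. An operator is therefore determined by its action on families.
    have hm : (n : ℂ) • m = ∑ g, D.glue (deltaFun j hi g) (D.germ g m) := by
      refine D.ext _ _ fun w => ?_
      have h1 (g : G) : (extendByZero i j (w * g⁻¹)).1 (D.germ g m) =
          if w * g⁻¹ ∈ Set.range i then D.germ w m else 0 := by
        split_ifs with hg
        · obtain ⟨k, hk⟩ := hg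
          rw [← hk, extendByZero_apply hi, ← D.germ_mul, hk, inv_mul_cancel_right]
        · rw [extendByZero_of_notMem hg]; rfl
      rw [map_smul, map_sum, Nat.cast_smul_eq_nsmul]
      simp only [germ_glue, deltaFun, h1]
      rw [hn, ← Finset.sum_const, Finset.sum_filter]
      exact (Fintype.sum_equiv (Equiv.divLeft w) _ _ fun g => by simp [div_eq_mul_inv]).symm
    have h2 : T.1 ((n : ℂ) • m) = T'.1 ((n : ℂ) • m) := by
      rw [hm, map_sum, map_sum]
      refine Finset.sum_congr rfl fun g _ => ?_
      rw [← intertwines_centralizerHom hB T, ← intertwines_centralizerHom hB T', h]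
    rw [map_smul, map_smul] at h2
    exact smul_right_injective M hn0 h2
  · intro S
    choose C hC hC' using hA
    -- These are the matrix coefficients of `S`; `T g g'` moves the germ at `g'` to the corner,
    -- applies the coefficient, and moves the result to `g`.
    let a (g g' : G) : A := (S (deltaFun j hi g')).1 g
    let T (g g' : G) : B := ρ g⁻¹ * ⟨C _ (a g g').2, hC _ _⟩ * ρ g'
    have hT (g g' : G) (w : G) (m : M) : D.germ w ((T g g').1 m) =
        (extendByZero i j (w * g⁻¹) * a g g').1 (D.germ g' m) := by
      change D.germ w ((ρ g⁻¹).1 (C _ _ ((ρ g').1 m))) = _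
      rw [hρ, (hC' _ (a g g').2).germ_eq hi, hρ, one_mul]
    -- Both the row and the column index run over `G` instead of cosets, so each overcounts by `n`.
    refine ⟨((n : ℂ)⁻¹ * (n : ℂ)⁻¹) • ∑ g, ∑ g', T g g',
      (intertwines_centralizerHom hB _).unique fun f ψ => D.ext _ _ fun w => ?_⟩
    have h1 : (n : ℂ) • f = ∑ g', MulOpposite.op (f.1 g') • deltaFun j hi g' := by
      refine Subtype.ext (funext fun w => ?_)
      have := sum_extendByZero_mul hi f w
      rw [← hn, ← Nat.cast_smul_eq_nsmul ℂ] at this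
      refine this.symm.trans ?_
      rw [AddSubmonoidClass.coe_finsetSum, Finset.sum_apply]
      rfl
    have h2 (g : G) : ∑ g', a g g' * f.1 g' = (n : ℂ) • (S f).1 g := by
      have h3 : (n : ℂ) • S f = ∑ g', MulOpposite.op (f.1 g') • S (deltaFun j hi g') := by
        simp only [← map_smul, ← map_sum, ← h1]
        rw [Nat.cast_smul_eq_nsmul, Nat.cast_smul_eq_nsmul, map_nsmul]
      have h4 := congrFun (congrArg Subtype.val h3) g
      rw [AddSubmonoidClass.coe_finsetSum, Finset.sum_apply] at h4
      exact h4.symm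
    have h5 : ∑ g, ∑ g', extendByZero i j (w * g⁻¹) * a g g' * f.1 g' =
        ((n : ℂ) * n) • (S f).1 w := by
      simp only [mul_assoc, ← Finset.mul_sum, h2, mul_smul_comm, ← Finset.smul_sum]
      rw [sum_extendByZero_mul hi (S f) w, ← hn, ← Nat.cast_smul_eq_nsmul ℂ, smul_smul]
    have h6 : (S f).1 w = ((n : ℂ)⁻¹ * (n : ℂ)⁻¹) •
        ∑ g, ∑ g', extendByZero i j (w * g⁻¹) * a g g' * f.1 g' := by
      rw [h5, smul_smul, mul_mul_mul_comm, inv_mul_cancel₀ hn0, one_mul, one_smul]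
    rw [germ_glue, h6]
    simp only [SetLike.val_smul, AddSubmonoidClass.coe_finsetSum, LinearMap.smul_apply,
      LinearMap.sum_apply, map_smul, map_sum, hT, germ_glue]
    rfl

end GermSystem

end GermSystem

end

end Cherednik

namespace Cherednik

noncomputable section

open Module

variable {V : Type*} [AddCommGroup V] [Module ℂ V] {W : Subgroup (V ≃ₗ[ℂ] V)}
  (r : Roots W) (c : reflections W → ℂ) (b : V)

/-! ### The isomorphism -/

/-- The action of `W_b` in its completed algebra. -/
abbrev localGrp : pointStabilizer W b →* localCompletion r c b :=
  completion.grp (r.restrict (pointStabilizer_le W b)) (restrictParam (pointStabilizer_le W b) c) 0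

/-- The identification of functions on the formal neighbourhood of the orbit of `b` with
`W_b`-equivariant families of power series. -/
def orbitGerms [Finite W] : GermSystem (Subgroup.inclusion (pointStabilizer_le W b))
    (localGrp r c b) (FormalFun W b) where
  germ w := (germ b w).toLinearMap
  germ_mul h w φ := germ_inclusion_mul h w φ
  ext _ _ h := germ_ext h
  exists_germ _ hq := exists_germ_eq hq

variable {r c b}

lemma notMem_range_inclusion_iff {w : W} :
    w ∉ Set.range (Subgroup.inclusion (pointStabilizer_le W b)) ↔
      (w : V ≃ₗ[ℂ] V) ∉ pointStabilizer W b := by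
  rw [not_iff_not]
  constructor
  · rintro ⟨h, rfl⟩
    exact h.2
  · intro h
    exact ⟨⟨w, h⟩, rfl⟩

variable [Finite W]

lemma orbitGerms_germ (w : W) (φ : FormalFun W b) :
    (orbitGerms r c b).germ w φ = germ b w φ := rfl

variable (r c b) in
/-- The action of the Dunkl-Opdam operator of `a` on families of operators. -/
def dunklFamily (a : V) (f : W → localCompletion r c b) (w : W) : localCompletion r c b :=
  completion.dunklOp _ _ 0 ((w : V ≃ₗ[ℂ] V) a) * f w +
    ∑ᶠ (s : reflections W) (_ : s.1 ∉ pointStabilizer W b),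
      (2 * c s / (1 - r.eig s)) •
        (completion.func _ _ 0 (r.root s ((w : V ≃ₗ[ℂ] V) a) • invShifted W b (r.root s)) *
          (f (⟨s.1, s.2.1⟩ * w) - f w))

lemma dunklFamily_apply [FiniteDimensional ℂ V] (hc : IsInvariant c) (a : V)
    (f : W → localCompletion r c b) (w : W) (ψ : FormalFun (pointStabilizer W b) 0)
    (φ : FormalFun W b) (hφ : ∀ w, germ b w φ = (f w).1 ψ) :
    (dunklFamily r c b a f w).1 ψ = germ b w ((completion.dunklOp r c b a).1 φ) := by
  classical
  have := Fintype.ofFinite (reflections W)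
  rw [germ_dunklOp r c hc, dunklFamily, finsum_eq_sum_of_fintype]
  simp only [finsum_eq_if, hφ]
  rw [AddMemClass.coe_add, LinearMap.add_apply, AddSubmonoidClass.coe_finsetSum,
    LinearMap.sum_apply]
  congr 1
  refine Finset.sum_congr rfl fun s _ => ?_
  by_cases hs : (s : V ≃ₗ[ℂ] V) ∈ pointStabilizer W b
  · rw [if_neg (not_not.2 hs), if_pos hs]; rfl
  · rw [if_pos hs, if_neg hs]; rfl

/-- Operators that intertwine with some `S` are closed under the algebra operations, so generators
suffice. For these the germ formulas have coefficients in the local algebra. -/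
lemma exists_intertwines [FiniteDimensional ℂ V] (hc : IsInvariant c)
    (T : Module.End ℂ (FormalFun W b)) (hT : T ∈ completion r c b) :
    ∃ S, (orbitGerms r c b).Intertwines T S := by
  induction hT using Algebra.adjoin_induction with
  | mem T hT =>
    obtain ((⟨φ, rfl⟩ | ⟨u, rfl⟩) | ⟨a, rfl⟩) := hT
    · refine GermSystem.exists_intertwines_of_apply
        (fun f w => completion.func _ _ 0 (germ b w φ) * f.1 w) fun f w ψ => ?_
      change germ b w φ * (f.1 w).1 ψ = germ b w (φ * (orbitGerms r c b).glue f ψ)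
      rw [map_mul, ← GermSystem.germ_glue (orbitGerms r c b)]
      rfl
    · refine GermSystem.exists_intertwines_of_apply (fun f w => f.1 (w * u)) fun f w ψ => ?_
      rw [orbitGerms_germ, germ_formalAct, ← GermSystem.germ_glue (orbitGerms r c b)]
      rfl
    · exact GermSystem.exists_intertwines_of_apply (fun f w => dunklFamily r c b a f.1 w)
        fun f w ψ => dunklFamily_apply hc a f.1 w ψ _ ((orbitGerms r c b).germ_glue f ψ)
  | algebraMap t => exact ⟨_, .algebraMap t⟩
  | add T T' _ _ h h' =>
    obtain ⟨S, h⟩ := h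
    obtain ⟨S', h'⟩ := h'
    exact ⟨_, h.add h'⟩
  | mul T T' _ _ h h' =>
    obtain ⟨S, h⟩ := h
    obtain ⟨S', h'⟩ := h'
    exact ⟨_, h.mul h'⟩

/-- A power series at `b`, extended by zero to the other points of the orbit. -/
lemma exists_germ_supported (ψ : FormalFun (pointStabilizer W b) 0) :
    ∃ φ : FormalFun W b, germ b 1 φ = ψ ∧
      ∀ w : W, (w : V ≃ₗ[ℂ] V) ∉ pointStabilizer W b → germ b w φ = 0 := by
  classical
  let q (w : W) : FormalFun (pointStabilizer W b) 0 :=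
    if h : (w : V ≃ₗ[ℂ] V) ∈ pointStabilizer W b then
      formalAct (pointStabilizer W b) 0 ⟨w, h⟩ ψ else 0
  have hq (w : W) (h : (w : V ≃ₗ[ℂ] V) ∈ pointStabilizer W b) :
      q w = formalAct (pointStabilizer W b) 0 ⟨w, h⟩ ψ := dif_pos h
  have hq' (w : W) (h : (w : V ≃ₗ[ℂ] V) ∉ pointStabilizer W b) : q w = 0 := dif_neg h
  obtain ⟨φ, hφ⟩ := exists_germ_eq (q := q) fun h w => by
    by_cases hw : (w : V ≃ₗ[ℂ] V) ∈ pointStabilizer W b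
    · rw [hq w hw, hq _ (mul_mem h.2 hw), ← Module.End.mul_apply, ← map_mul]
      rfl
    · rw [hq' w hw, hq' _ fun h' => hw ((mul_mem_cancel_left h.2).1 h'), map_zero]
  refine ⟨φ, ?_, fun w hw => (hφ w).trans (hq' w hw)⟩
  rw [hφ, hq 1 (one_mem _)]
  exact DFunLike.congr_fun (map_one (formalAct (pointStabilizer W b) 0)) ψ

/-- After multiplication by `e`, the terms `f (s w)` with `s ∉ W_b` vanish near `b`. Only their
companions `-f w` survive, a multiplication operator cancelled by the added sum. -/
lemma germ_dunklOp_mul_idempotent [FiniteDimensional ℂ V] (hc : IsInvariant c)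
    [Fintype (reflections W)]
    [DecidablePred fun s : reflections W => (s : V ≃ₗ[ℂ] V) ∈ pointStabilizer W b]
    {e : FormalFun W b} (he : germ b 1 e = 1)
    (he' : ∀ w : W, (w : V ≃ₗ[ℂ] V) ∉ pointStabilizer W b → germ b w e = 0)
    (a : V) (φ : FormalFun W b) :
    germ b 1 ((completion.dunklOp r c b a).1 (e * φ)) +
        (∑ s : reflections W, if (s : V ≃ₗ[ℂ] V) ∈ pointStabilizer W b then 0 else
          (2 * c s / (1 - r.eig s)) • (r.root s a • invShifted W b (r.root s))) * germ b 1 φ =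
      (completion.dunklOp (r.restrict (pointStabilizer_le W b))
        (restrictParam (pointStabilizer_le W b) c) 0 a).1 (germ b 1 φ) := by
  rw [germ_dunklOp r c hc, map_mul, he, one_mul, add_assoc, Finset.sum_mul,
    ← Finset.sum_add_distrib]
  refine (congrArg₂ (· + ·) rfl (Finset.sum_eq_zero fun s _ => ?_)).trans (add_zero _)
  split_ifs with hs
  · rw [zero_mul, add_zero]
  · have h1 : germ b (⟨s, s.2.1⟩ * 1) e = 0 := he' _ (by simpa using hs)
    have h2 : ((1 : W) : V ≃ₗ[ℂ] V) a = a := rfl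
    rw [h2, map_mul, h1, zero_mul, zero_sub, mul_neg, smul_neg,
      smul_mul_assoc (2 * c s / (1 - r.eig s)), neg_add_cancel]

lemma exists_isCorner_mulLeft (ψ : FormalFun (pointStabilizer W b) 0) :
    ∃ T ∈ completion r c b, (orbitGerms r c b).IsCorner T (LinearMap.mulLeft ℂ ψ) := by
  obtain ⟨χ, hχ, hχ'⟩ := exists_germ_supported (W := W) ψ
  refine ⟨_, (completion.func r c b χ).2, fun φ => ?_, fun w hw φ => ?_⟩
  · change germ b 1 (χ * φ) = ψ * germ b 1 φ
    rw [map_mul, hχ]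
  · change germ b w (χ * φ) = 0
    rw [map_mul, hχ' w (notMem_range_inclusion_iff.1 hw), zero_mul]

lemma exists_isCorner_formalAct (u : pointStabilizer W b) :
    ∃ T ∈ completion r c b,
      (orbitGerms r c b).IsCorner T (formalAct (pointStabilizer W b) 0 u) := by
  obtain ⟨e, he, he'⟩ := exists_germ_supported (W := W) (b := b) 1
  refine ⟨_, (completion.func r c b e * completion.grp r c b
    (Subgroup.inclusion (pointStabilizer_le W b) u)).2, fun φ => ?_, fun w hw φ => ?_⟩
  · change germ b 1 (e * formalAct W b _ φ) = formalAct _ 0 u (germ b 1 φ)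
    rw [map_mul, he, one_mul, germ_formalAct, one_mul, ← germ_inclusion_mul, mul_one]
  · change germ b w (e * formalAct W b _ φ) = 0
    rw [map_mul, he' w (notMem_range_inclusion_iff.1 hw), zero_mul]

lemma exists_isCorner_dunklOp [FiniteDimensional ℂ V] (hc : IsInvariant c) (a : V) :
    ∃ T ∈ completion r c b, (orbitGerms r c b).IsCorner T
      (completion.dunklOp (r.restrict (pointStabilizer_le W b))
        (restrictParam (pointStabilizer_le W b) c) 0 a).1 := by
  classical
  have := Fintype.ofFinite (reflections W)
  obtain ⟨e, he, he'⟩ := exists_germ_supported (W := W) (b := b) 1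
  obtain ⟨χ, hχ, hχ'⟩ := exists_germ_supported (W := W) (b := b)
    (∑ s : reflections W, if (s : V ≃ₗ[ℂ] V) ∈ pointStabilizer W b then 0 else
      (2 * c s / (1 - r.eig s)) • (r.root s a • invShifted W b (r.root s)))
  -- The inner `e` removes contributions from other points, the outer `e` restricts the support to
  -- `b`, and `χ` corrects the leftover multiplication.
  refine ⟨_, (completion.func r c b e * (completion.dunklOp r c b a *
    completion.func r c b e) + completion.func r c b χ).2, fun φ => ?_, fun w hw φ => ?_⟩
  · change germ b 1 (e * (completion.dunklOp r c b a).1 (e * φ) + χ * φ) = _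
    rw [map_add, map_mul (germ b 1), map_mul (germ b 1) χ, he, one_mul, hχ,
      germ_dunklOp_mul_idempotent hc he he']
    rfl
  · change germ b w (e * (completion.dunklOp r c b a).1 (e * φ) + χ * φ) = 0
    rw [map_add, map_mul (germ b w), map_mul (germ b w) χ,
      he' w (notMem_range_inclusion_iff.1 hw), hχ' w (notMem_range_inclusion_iff.1 hw), zero_mul,
      zero_mul, add_zero]

lemma exists_isCorner [FiniteDimensional ℂ V] (hc : IsInvariant c)
    (m : Module.End ℂ (FormalFun (pointStabilizer W b) 0)) (hm : m ∈ localCompletion r c b) :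
    ∃ T ∈ completion r c b, (orbitGerms r c b).IsCorner T m := by
  induction hm using Algebra.adjoin_induction with
  | mem m hm =>
    obtain ((⟨ψ, rfl⟩ | ⟨u, rfl⟩) | ⟨a, rfl⟩) := hm
    · exact exists_isCorner_mulLeft ψ
    · exact exists_isCorner_formalAct u
    · exact exists_isCorner_dunklOp hc a
  | algebraMap t =>
    -- The scalar operator itself is not supported near `b`, so the constant series extended by zero
    -- is used instead.
    obtain ⟨T, hT, h⟩ := exists_isCorner_mulLeft (r := r) (c := c) (b := b) (algebraMap ℂ _ t)
    exact ⟨T, hT, fun φ => (h.1 φ).trans (Algebra.smul_def t _).symm, h.2⟩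
  | add m m' _ _ h h' =>
    obtain ⟨T, hT, h⟩ := h
    obtain ⟨T', hT', h'⟩ := h'
    exact ⟨_, add_mem hT hT', h.add h'⟩
  | mul m m' _ _ h h' =>
    obtain ⟨T, hT, h⟩ := h
    obtain ⟨T', hT', h'⟩ := h'
    exact ⟨_, mul_mem hT hT', h.mul h'⟩

variable (r b) in
/-- The homomorphism from the completion of `H_c(W, V)` at `b` to the centralizer algebra. -/
def thetaHom [FiniteDimensional ℂ V] (hc : IsInvariant c) :
    completion r c b →ₐ[ℂ] localCentralizer r c b :=
  GermSystem.centralizerHom (D := orbitGerms r c b) (B := completion r c b) (exists_intertwines hc)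

lemma bijective_thetaHom [FiniteDimensional ℂ V] (hc : IsInvariant c) :
    Function.Bijective (thetaHom r b hc) :=
  GermSystem.bijective_centralizerHom (D := orbitGerms r c b) (B := completion r c b)
    (Subgroup.inclusion_injective (pointStabilizer_le W b)) (exists_intertwines hc)
    (completion.grp r c b) (fun u w φ => germ_formalAct u w φ) (exists_isCorner hc)

variable (r b) in
/-- The isomorphism from the completion of `H_c(W, V)` at `b` to the centralizer algebra. -/
def theta [FiniteDimensional ℂ V] (hc : IsInvariant c) :
    completion r c b ≃ₐ[ℂ] localCentralizer r c b :=
  AlgEquiv.ofBijective (thetaHom r b hc) (bijective_thetaHom hc)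

lemma theta_apply [FiniteDimensional ℂ V] (hc : IsInvariant c) (T : completion r c b)
    (f : funH (Subgroup.inclusion (pointStabilizer_le W b)) (localGrp r c b)) (w : W)
    (ψ : FormalFun (pointStabilizer W b) 0) :
    ((theta r b hc T f).1 w).1 ψ = germ b w (T.1 ((orbitGerms r c b).glue f ψ)) :=
  (GermSystem.intertwines_centralizerHom (D := orbitGerms r c b) (B := completion r c b)
    (exists_intertwines hc) T).apply f w ψ

end

end Cherednik

/-! ### Formulas for the isomorphism and its uniqueness -/

namespace Cherednik

noncomputable section

open Module

variable {V : Type*} [AddCommGroup V] [Module ℂ V] {W : Subgroup (V ≃ₗ[ℂ] V)} {r : Roots W}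
  {c : reflections W → ℂ} {b : V}

lemma IsInvariant.restrictParam {W' : Subgroup (V ≃ₗ[ℂ] V)} (hc : IsInvariant c) (h : W' ≤ W) :
    IsInvariant (restrictParam h c) :=
  fun _ _ w hw e => hc _ _ w (h hw) e

lemma germ_formalLin [Finite W] (w : W) (α : Dual ℂ V) :
    germ b w (formalLin W b α) = formalLin (pointStabilizer W b) 0 (dualAct (w : V ≃ₗ[ℂ] V) α) +
      algebraMap ℂ _ (dualAct (w : V ≃ₗ[ℂ] V) α b) := by
  rw [formalLin, germ_of, polyGerm_apply, polyAct_lin, polyShift_lin, map_add, of_algebraMap]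
  rfl

lemma func_add_algebraMap (φ : FormalFun W b) (t : ℂ) :
    completion.func r c b (φ + algebraMap ℂ _ t) =
      completion.func r c b φ + algebraMap ℂ _ t := by
  refine Subtype.ext (LinearMap.ext fun ψ => (add_mul φ _ ψ).trans ?_)
  rw [← Algebra.smul_def]
  rfl

variable [FiniteDimensional ℂ V] [Finite W]

lemma theta_grp (hc : IsInvariant c) (u : W)
    (f : funH (Subgroup.inclusion (pointStabilizer_le W b)) (localGrp r c b)) (w : W) :
    (theta r b hc (completion.grp r c b u) f).1 w = f.1 (w * u) := by
  refine Subtype.ext (LinearMap.ext fun ψ => ?_)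
  rw [theta_apply]
  exact (germ_formalAct u w _).trans ((orbitGerms r c b).germ_glue f ψ (w * u))

lemma theta_func (hc : IsInvariant c) (φ : FormalFun W b)
    (f : funH (Subgroup.inclusion (pointStabilizer_le W b)) (localGrp r c b)) (w : W) :
    (theta r b hc (completion.func r c b φ) f).1 w =
      completion.func _ _ 0 (germ b w φ) * f.1 w := by
  refine Subtype.ext (LinearMap.ext fun ψ => ?_)
  rw [theta_apply]
  exact (map_mul (germ b w) φ _).trans
    (congrArg (germ b w φ * ·) ((orbitGerms r c b).germ_glue f ψ w))

lemma theta_dunklOp (hc : IsInvariant c) (a : V)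
    (f : funH (Subgroup.inclusion (pointStabilizer_le W b)) (localGrp r c b)) (w : W) :
    (theta r b hc (completion.dunklOp r c b a) f).1 w = dunklFamily r c b a f.1 w := by
  refine Subtype.ext (LinearMap.ext fun ψ => ?_)
  rw [theta_apply]
  exact (dunklFamily_apply hc a f.1 w ψ _ ((orbitGerms r c b).germ_glue f ψ)).symm

lemma theta_lin (hc : IsInvariant c) (α : Dual ℂ V)
    (f : funH (Subgroup.inclusion (pointStabilizer_le W b)) (localGrp r c b)) (w : W) :
    (theta r b hc (completion.func r c b (formalLin W b α)) f).1 w =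
      (completion.func _ _ 0 (formalLin (pointStabilizer W b) 0 (dualAct (w : V ≃ₗ[ℂ] V) α)) +
        algebraMap ℂ _ (dualAct (w : V ≃ₗ[ℂ] V) α b)) * f.1 w := by
  refine (theta_func hc _ f w).trans (congrArg (· * f.1 w) ?_)
  rw [germ_formalLin, func_add_algebraMap]

lemma existsUnique_theta (hc : IsInvariant c) :
    ∃! θ : completion r c b ≃ₐ[ℂ] localCentralizer r c b,
      (∀ u f (w : W), (θ (completion.grp r c b u) f).1 w = f.1 (w * u)) ∧
      (∀ α f (w : W), (θ (completion.func r c b (formalLin W b α)) f).1 w =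
        (completion.func _ _ 0 (formalLin (pointStabilizer W b) 0 (dualAct w.1 α)) +
          algebraMap ℂ _ (dualAct w.1 α b)) * f.1 w) ∧
      ∀ a f (w : W), (θ (completion.dunklOp r c b a) f).1 w = dunklFamily r c b a f.1 w := by
  refine ⟨theta r b hc, ⟨theta_grp hc, theta_lin hc, theta_dunklOp hc⟩, ?_⟩
  rintro θ ⟨h1, h2, h3⟩
  refine algEquiv_ext_of_generators _ θ (fun u => ?_) (fun α => ?_) fun a => ?_
  · exact LinearMap.ext fun f => Subtype.ext (funext fun w =>
      (h1 u f w).trans (theta_grp hc u f w).symm)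
  · exact LinearMap.ext fun f => Subtype.ext (funext fun w =>
      (h2 α f w).trans (theta_lin hc α f w).symm)
  · exact LinearMap.ext fun f => Subtype.ext (funext fun w =>
      (h3 a f w).trans (theta_dunklOp hc a f w).symm)

end

end Cherednik

theorem mainTheorem1 {V : Type*} [AddCommGroup V] [Module ℂ V] [FiniteDimensional ℂ V]
    (W : Subgroup (V ≃ₗ[ℂ] V)) [Finite W] (r : Cherednik.Roots W)
    (c : Cherednik.reflections W → ℂ) (hc : Cherednik.IsInvariant c) (b : V) :
    ∃ (ι : Cherednik.Alg r c →ₐ[ℂ] Cherednik.completion r c b)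
      (ι' : Cherednik.Alg (r.restrict (Cherednik.pointStabilizer_le W b))
          (Cherednik.restrictParam (Cherednik.pointStabilizer_le W b) c) →ₐ[ℂ]
        Cherednik.localCompletion r c b),
      Cherednik.IsNatural r c b ι ∧ Cherednik.IsNatural _ _ 0 ι' ∧
      ∃! θ : Cherednik.completion r c b ≃ₐ[ℂ] Cherednik.localCentralizer r c b,
        (∀ u f (w : W), (θ (ι (Cherednik.Alg.grp r c u)) f).1 w = f.1 (w * u)) ∧
        (∀ α f (w : W), (θ (ι (Cherednik.Alg.x r c α)) f).1 w =
          (ι' (Cherednik.Alg.x _ _ (Cherednik.dualAct w.1 α)) +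
            algebraMap ℂ _ (Cherednik.dualAct w.1 α b)) * f.1 w) ∧
        (∀ a f (w : W), (θ (ι (Cherednik.Alg.y r c a)) f).1 w =
          ι' (Cherednik.Alg.y _ _ (w.1 a)) * f.1 w +
            ∑ᶠ (s : Cherednik.reflections W) (_ : s.1 ∉ Cherednik.pointStabilizer W b),
              (2 * c s / (1 - r.eig s)) •
                (Cherednik.completion.func _ _ 0
                    (r.root s (w.1 a) • Cherednik.invShifted W b (r.root s)) *
                  (f.1 (⟨s.1, s.2.1⟩ * w) - f.1 w))) := by
  have hc' := hc.restrictParam (Cherednik.pointStabilizer_le W b)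
  have hι := Cherednik.isNatural_naturalHom (r := r) (b := b) hc
  have hι' := Cherednik.isNatural_naturalHom
    (r := r.restrict (Cherednik.pointStabilizer_le W b)) (b := 0) hc'
  refine ⟨Cherednik.naturalHom r b hc, Cherednik.naturalHom _ 0 hc', hι, hι', ?_⟩
  -- Naturality replaces the images of the generators by operators, so that no further property of
  -- the two homomorphisms enters.
  simp only [hι.1, hι.2.1, hι.2.2, hι'.2.1, hι'.2.2]
  exact Cherednik.existsUnique_theta hc
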